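/- Let $k$ be a field and let $B=k[x_1,\dots,x_n]$ be the polynomial ring with its standard grading ($\deg x_j=1$). Let $C\subseteq B$ be a graded $k$-subalgebra (it contains the homogeneous components of its elements) such that the inclusion $C\hookrightarrow B$ is split as a map of $C$-modules, and let $I=C_+B$ be the ideal of $B$ generated by the elements of $C$ of positive degree. For a graded module $M$, let $\operatorname{end}(M)\in\mathbb Z\cup\{\pm\infty\}$ be the largest degree in which $M$ is nonzero ($\infty$ if there is no bound on such degrees, $-\infty$ if $M=0$). For $A=B$ or $A=C$ and a graded $A$-module $M$, put $t^A_i(M)=\operatorname{end}(\operatorname{Tor}^A_i(M,k))$, where $k=A/A_+$ and $\operatorname{Tor}$ carries its internal grading. Then $$t^C_0(k)=0,\qquad t^C_1(k)\le \operatorname{end}(B/I)+1,\qquad t^C_i(k)\le(\operatorname{end}(B/I)+2)\,i-2\quad\text{for all } i\ge 2.$$ If, moreover, $t^B_1(I)\le\operatorname{end}(B/I)+1$, then $$t^C_i(k)\le(\operatorname{end}(B/I)+1)\,i-1\quad\text{for all } i\ge 2.$$ -/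

import Mathlib

open DirectSum TensorProduct

universe u v w

noncomputable section

/-! ### The end of a graded module -/

/-- The end of a graded module `X = ⨁ d, X d`: the largest degree in which it is nonzero, with
value `⊤ = ∞` if it is nonzero in arbitrarily large degrees and `⊥ = -∞` if it is zero. -/
def gradedEnd (X : ℕ → Type*) : EReal :=
  ⨆ (d : ℕ) (_ : Nontrivial (X d)), (d : EReal)

/-! ### Gradings on subobjects and quotients -/

section SubQuotient

variable {k : Type w} [CommRing k]

/-- The grading induced on a `k`-submodule `W` of a graded `k`-module. -/
def subGrading {M : Type u} [AddCommGroup M] [Module k M] (ℳ : ℕ → Submodule k M)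
    (W : Submodule k M) (d : ℕ) : Submodule k W :=
  (ℳ d).comap W.subtype

/-- A homogeneous submodule is the direct sum of its homogeneous components. -/
abbrev subDecomposition {M : Type u} [AddCommGroup M] [Module k M] (ℳ : ℕ → Submodule k M)
    [Decomposition ℳ] (W : Submodule k M) (hW : SetLike.IsHomogeneous ℳ W) :
    Decomposition (subGrading ℳ W) :=
  IsInternal.chooseDecomposition _ <| by
    classical
    have key : ∀ y : ⨁ d, subGrading ℳ W d, ∀ d,
        (decompose ℳ ((DirectSum.coeAddMonoidHom (subGrading ℳ W) y : W) : M) d : M)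
          = ((y d : W) : M) := by
      intro y d
      induction y using DirectSum.induction_on with
      | zero => simp
      | of i x =>
        rw [DirectSum.coeAddMonoidHom_of]
        have hx : ((x : W) : M) ∈ ℳ i := x.2
        by_cases h : i = d
        · subst h
          rw [decompose_of_mem_same ℳ hx]; simp
        · rw [decompose_of_mem_ne ℳ hx h, DirectSum.of_eq_of_ne _ _ _ (Ne.symm h)]; simp
      | add x y hx hy =>
        simp only [map_add, Submodule.coe_add, decompose_add, DirectSum.add_apply, hx, hy]
    constructor
    · intro y z hyz
      refine DFinsupp.ext fun d => Subtype.ext (Subtype.ext ?_)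
      have := key y d
      rw [hyz, key z d] at this
      exact this.symm
    · intro x
      refine ⟨∑ d ∈ (decompose ℳ (x : M)).support, DirectSum.of (fun d => subGrading ℳ W d) d
        ⟨⟨(decompose ℳ (x : M) d : M), hW d x.2⟩, (decompose ℳ (x : M) d).2⟩, ?_⟩
      apply Subtype.ext
      rw [map_sum]
      simp only [DirectSum.coeAddMonoidHom_of, Submodule.coe_sum]
      exact sum_support_decompose ℳ (x : M)

variable {A : Type u} [CommRing A] [Algebra k A] {𝒜 : ℕ → Submodule k A} [GradedAlgebra 𝒜]

namespace HomogeneousIdeal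

/-- The grading `I_d = I ∩ A_d` of a homogeneous ideal `I ⊆ A`. -/
def grading (I : HomogeneousIdeal 𝒜) (d : ℕ) : Submodule k I.toIdeal :=
  subGrading 𝒜 (I.toIdeal.restrictScalars k) d

instance (I : HomogeneousIdeal 𝒜) : Decomposition I.grading :=
  subDecomposition 𝒜 (I.toIdeal.restrictScalars k) I.isHomogeneous

instance (I : HomogeneousIdeal 𝒜) : SetLike.GradedSMul 𝒜 I.grading where
  smul_mem {_ _ _ b} ha hb := SetLike.GradedMul.mul_mem (A := 𝒜) ha (show (b : A) ∈ 𝒜 _ from hb)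

/-- The grading of `A ⧸ I` whose degree `d` part is the image of `A_d`. -/
def quotientGrading (I : HomogeneousIdeal 𝒜) (d : ℕ) : Submodule k (A ⧸ I.toIdeal) :=
  (𝒜 d).map (Ideal.Quotient.mkₐ k I.toIdeal).toLinearMap

instance (I : HomogeneousIdeal 𝒜) : Decomposition I.quotientGrading :=
  IsInternal.chooseDecomposition _ <| by
    classical
    have lift : ∀ y : ⨁ d, I.quotientGrading d, ∃ a : A,
        Ideal.Quotient.mk I.toIdeal a = DirectSum.coeAddMonoidHom I.quotientGrading y ∧
        ∀ d, Ideal.Quotient.mk I.toIdeal (decompose 𝒜 a d : A) = y d := by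
      intro y
      induction y using DirectSum.induction_on with
      | zero => exact ⟨0, by simp, by simp⟩
      | of i x =>
        obtain ⟨x, a, ha, rfl⟩ := x
        refine ⟨a, by simp, fun d => ?_⟩
        by_cases h : i = d
        · subst h
          rw [decompose_of_mem_same 𝒜 ha]; simp
        · rw [decompose_of_mem_ne 𝒜 ha h, DirectSum.of_eq_of_ne _ _ _ (Ne.symm h)]; simp
      | add x y hx hy =>
        obtain ⟨a, ha, ha'⟩ := hx
        obtain ⟨b, hb, hb'⟩ := hy
        exact ⟨a + b, by simp [ha, hb], fun d => by simp [decompose_add, ha', hb']⟩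
    constructor
    · rw [injective_iff_map_eq_zero]
      intro y hy
      obtain ⟨a, ha, ha'⟩ := lift y
      rw [hy, Ideal.Quotient.eq_zero_iff_mem] at ha
      refine DFinsupp.ext fun d => Subtype.ext ?_
      rw [← ha' d]
      exact Ideal.Quotient.eq_zero_iff_mem.mpr (I.isHomogeneous d ha)
    · intro x
      obtain ⟨a, rfl⟩ := Ideal.Quotient.mk_surjective x
      refine ⟨∑ d ∈ (decompose 𝒜 a).support, DirectSum.of (fun d => I.quotientGrading d) d
        ⟨Ideal.Quotient.mk _ (decompose 𝒜 a d : A), _, (decompose 𝒜 a d).2, rfl⟩, ?_⟩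
      rw [map_sum]
      simp only [DirectSum.coeAddMonoidHom_of]
      rw [← map_sum, sum_support_decompose 𝒜 a]

instance (I : HomogeneousIdeal 𝒜) : SetLike.GradedSMul 𝒜 I.quotientGrading where
  smul_mem {_ _ a b} ha hb := by
    obtain ⟨b, hb, rfl⟩ := hb
    exact ⟨a * b, SetLike.GradedMul.mul_mem ha hb, rfl⟩

end HomogeneousIdeal

/-- The residue module `A ⧸ A₊`. It is `k`, concentrated in degree `0`, when `A_0 = k`. -/
abbrev ResidueModule (𝒜 : ℕ → Submodule k A) [GradedAlgebra 𝒜] : Type u :=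
  A ⧸ (HomogeneousIdeal.irrelevant 𝒜).toIdeal

/-- The grading of the residue module `A ⧸ A₊`. -/
abbrev residueGrading (𝒜 : ℕ → Submodule k A) [GradedAlgebra 𝒜] :
    ℕ → Submodule k (ResidueModule 𝒜) :=
  (HomogeneousIdeal.irrelevant 𝒜).quotientGrading

/-- A graded subalgebra: a subalgebra that contains the homogeneous components of its elements. -/
structure HomogeneousSubalgebra (𝒜 : ℕ → Submodule k A) [GradedAlgebra 𝒜]
    extends Subalgebra k A where
  isHomogeneous' : SetLike.IsHomogeneous 𝒜 toSubalgebra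

namespace HomogeneousSubalgebra

variable (C : HomogeneousSubalgebra 𝒜)

/-- The grading `C_d = C ∩ A_d` of a graded subalgebra `C ⊆ A`. -/
def grading (d : ℕ) : Submodule k C.toSubalgebra :=
  subGrading 𝒜 (Subalgebra.toSubmodule C.toSubalgebra) d

instance : GradedAlgebra C.grading where
  one_mem := SetLike.GradedOne.one_mem (A := 𝒜)
  mul_mem _ _ a b ha hb := SetLike.GradedMul.mul_mem (A := 𝒜)
    (show (a : A) ∈ 𝒜 _ from ha) (show (b : A) ∈ 𝒜 _ from hb)
  toDecomposition :=
    subDecomposition 𝒜 (Subalgebra.toSubmodule C.toSubalgebra) C.isHomogeneous'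

/-- The inclusion `C → A` as a homomorphism of graded rings. -/
def inclusion : C.grading →+*ᵍ 𝒜 where
  toRingHom := C.toSubalgebra.val.toRingHom
  map_mem h := h

/-- The ideal `C₊ A` of `A`. -/
def extendedIrrelevant : HomogeneousIdeal 𝒜 :=
  (HomogeneousIdeal.irrelevant C.grading).map C.inclusion

/-- The inclusion `C → A` is split: it has a `C`-linear left inverse. -/
def IsSplit : Prop :=
  ∃ π : A →ₗ[C.toSubalgebra] C.toSubalgebra, ∀ c : C.toSubalgebra, π (c : A) = c

end HomogeneousSubalgebra

end SubQuotient

/-! ### Graded free modules -/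

section Free

variable {k : Type w} [CommRing k] {A : Type u} [CommRing A] [Algebra k A]
variable (𝒜 : ℕ → Submodule k A)

/-- The degree `n` part `A(-s)_n = A_{n-s}` of the free module `A(-s)` on a generator of
degree `s`. -/
def twist (s n : ℕ) : Submodule k A :=
  if s ≤ n then 𝒜 (n - s) else ⊥

/-- The degree `n` part of the free module on basis elements `c : ι` of degrees `deg c`. -/
def freeGrading {ι : Type v} (deg : ι → ℕ) (n : ℕ) : Submodule k (ι →₀ A) where
  carrier := {x | ∀ c, x c ∈ twist 𝒜 (deg c) n}
  add_mem' hx hy c := add_mem (hx c) (hy c)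
  zero_mem' _ := zero_mem _
  smul_mem' r _ hx c := Submodule.smul_mem _ r (hx c)

/-- The degree `n` part of a free module `P` with a basis of homogeneous elements `b c` of degrees
`deg c`: the elements all of whose coordinates with respect to `b c` have degree `n - deg c`. -/
def basisGrading {P : Type u} [AddCommGroup P] [Module k P] [Module A P] [IsScalarTower k A P]
    {ι : Type v} (b : Module.Basis ι A P) (deg : ι → ℕ) (n : ℕ) : Submodule k P :=
  (freeGrading 𝒜 deg n).comap (b.repr.toLinearMap.restrictScalars k)

variable {𝒜}

theorem single_mem_freeGrading {ι : Type v} (deg : ι → ℕ) (c : ι) {m : ℕ} {a : A}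
    (ha : a ∈ 𝒜 m) : Finsupp.single c a ∈ freeGrading 𝒜 deg (m + deg c) := by
  classical
  intro c'
  by_cases h : c = c'
  · subst h
    simpa [twist] using ha
  · rw [Finsupp.single_eq_of_ne (Ne.symm h)]
    exact zero_mem _

/-- A linear map from a graded free module preserves degree if it does so on the basis. -/
theorem linearCombination_mem [GradedAlgebra 𝒜] {ι : Type v} (deg : ι → ℕ) {M : Type u}
    [AddCommGroup M] [Module k M] [Module A M] (ℳ : ℕ → Submodule k M) [SetLike.GradedSMul 𝒜 ℳ]
    (f : ι → M) (hf : ∀ c, f c ∈ ℳ (deg c)) {n : ℕ} {x : ι →₀ A}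
    (hx : x ∈ freeGrading 𝒜 deg n) : Finsupp.linearCombination A f x ∈ ℳ n := by
  rw [Finsupp.linearCombination_apply, Finsupp.sum]
  refine sum_mem fun c _ => ?_
  have hc := hx c
  unfold twist at hc
  split_ifs at hc with h
  · have := SetLike.GradedSMul.smul_mem (A := 𝒜) (B := ℳ) hc (hf c)
    rwa [vadd_eq_add, Nat.sub_add_cancel h] at this
  · rw [(Submodule.mem_bot k).mp hc, zero_smul]
    exact zero_mem _

instance [GradedAlgebra 𝒜] {ι : Type v} (deg : ι → ℕ) :
    SetLike.GradedSMul 𝒜 (freeGrading 𝒜 deg) where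
  smul_mem {i n a x} ha hx c := by
    have hc := hx c
    simp only [twist, Finsupp.smul_apply, smul_eq_mul, vadd_eq_add] at hc ⊢
    by_cases h : deg c ≤ n
    · rw [if_pos h] at hc
      rw [if_pos (h.trans (Nat.le_add_left _ _)), Nat.add_sub_assoc h]
      exact SetLike.GradedMul.mul_mem ha hc
    · rw [if_neg h, Submodule.mem_bot] at hc
      rw [hc, mul_zero]
      exact zero_mem _

instance [GradedAlgebra 𝒜] {ι : Type v} (deg : ι → ℕ) : Decomposition (freeGrading 𝒜 deg) :=
  IsInternal.chooseDecomposition _ <| by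
    classical
    constructor
    · -- coordinatewise, the degree `n` part is a homogeneous component
      have key : ∀ y : ⨁ n, freeGrading 𝒜 deg n, ∀ n c, deg c ≤ n →
          (decompose 𝒜 ((DirectSum.coeAddMonoidHom (freeGrading 𝒜 deg) y) c) (n - deg c) : A)
            = (y n : ι →₀ A) c := by
        intro y n c hc
        induction y using DirectSum.induction_on with
        | zero => simp
        | of i x =>
          rw [DirectSum.coeAddMonoidHom_of]
          have hx := x.2 c
          unfold twist at hx
          by_cases h : i = n
          · subst h
            rw [if_pos hc] at hx
            rw [decompose_of_mem_same 𝒜 hx, DirectSum.of_eq_same]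
          · rw [DirectSum.of_eq_of_ne _ _ _ (Ne.symm h)]
            split_ifs at hx with h'
            · rw [decompose_of_mem_ne 𝒜 hx (by omega)]; simp
            · rw [(Submodule.mem_bot k).mp hx]; simp
        | add x y hx hy =>
          simp only [map_add, Finsupp.add_apply, decompose_add, DirectSum.add_apply,
            Submodule.coe_add, hx, hy]
      intro y z hyz
      refine DFinsupp.ext fun n => Subtype.ext (Finsupp.ext fun c => ?_)
      by_cases hc : deg c ≤ n
      · rw [← key y n c hc, hyz, key z n c hc]
      · have hy := (y n).2 c
        have hz := (z n).2 c
        unfold twist at hy hz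
        rw [if_neg hc, Submodule.mem_bot] at hy hz
        rw [hy, hz]
    · intro x
      induction x using Finsupp.induction_linear with
      | zero => exact ⟨0, map_zero _⟩
      | add x y hx hy =>
        obtain ⟨x, rfl⟩ := hx
        obtain ⟨y, rfl⟩ := hy
        exact ⟨x + y, map_add _ _ _⟩
      | single c a =>
        induction a using Decomposition.inductionOn 𝒜 with
        | zero => exact ⟨0, by simp⟩
        | homogeneous a =>
          exact ⟨DirectSum.of (fun n => freeGrading 𝒜 deg n) _
            ⟨_, single_mem_freeGrading deg c a.2⟩, by rw [DirectSum.coeAddMonoidHom_of]⟩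
        | add a b ha hb =>
          obtain ⟨x, hx⟩ := ha
          obtain ⟨y, hy⟩ := hb
          exact ⟨x + y, by rw [map_add, hx, hy, Finsupp.single_add]⟩

end Free

/-! ### Graded free resolutions -/

section Resolution

variable {k : Type w} [CommRing k] {A M : Type u} [CommRing A] [Algebra k A]
variable [AddCommGroup M] [Module k M] [Module A M]

/-- A graded free resolution `⋯ → F₁ → F₀ → M → 0` of the graded `A`-module `M`: each `F i` is
free on homogeneous basis elements of degrees `deg i c`, and all maps preserve degree. -/
structure GradedFreeResolution (𝒜 : ℕ → Submodule k A) (ℳ : ℕ → Submodule k M) where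
  /-- the terms of the resolution -/
  F : ℕ → Type u
  [addCommGroup : ∀ i, AddCommGroup (F i)]
  [moduleBase : ∀ i, Module k (F i)]
  [module : ∀ i, Module A (F i)]
  [isScalarTower : ∀ i, IsScalarTower k A (F i)]
  /-- the index set of the basis of `F i` -/
  ι : ℕ → Type u
  /-- the basis of `F i` -/
  basis : ∀ i, Module.Basis (ι i) A (F i)
  /-- the degrees of the basis elements -/
  deg : ∀ i, ι i → ℕ
  /-- the differential -/
  d : ∀ i, F (i + 1) →ₗ[A] F i
  /-- the augmentation -/
  aug : F 0 →ₗ[A] M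
  d_mem : ∀ i n, ∀ x ∈ basisGrading 𝒜 (basis (i + 1)) (deg (i + 1)) n,
    d i x ∈ basisGrading 𝒜 (basis i) (deg i) n
  aug_mem : ∀ n, ∀ x ∈ basisGrading 𝒜 (basis 0) (deg 0) n, aug x ∈ ℳ n
  exact_d : ∀ i, Function.Exact (d (i + 1)) (d i)
  exact_aug : Function.Exact (d 0) aug
  aug_surjective : Function.Surjective aug

attribute [instance] GradedFreeResolution.addCommGroup GradedFreeResolution.moduleBase
  GradedFreeResolution.module GradedFreeResolution.isScalarTower

/-- The kernel of a degree preserving map is homogeneous. -/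
theorem isHomogeneous_ker {P : Type u} [AddCommGroup P] [Module k P] [Module A P]
    (𝒟 : ℕ → Submodule k P) [Decomposition 𝒟] (ℳ : ℕ → Submodule k M) [Decomposition ℳ]
    (φ : P →ₗ[A] M) (hφ : ∀ n, ∀ x ∈ 𝒟 n, φ x ∈ ℳ n) :
    (LinearMap.ker φ).IsHomogeneous 𝒟 := by
  have key : ∀ x n, φ (decompose 𝒟 x n : P) = (decompose ℳ (φ x) n : M) := by
    intro x n
    induction x using Decomposition.inductionOn 𝒟 with
    | zero => simp
    | @homogeneous i x =>
      by_cases h : i = n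
      · subst h
        rw [decompose_of_mem_same 𝒟 x.2, decompose_of_mem_same ℳ (hφ _ _ x.2)]
      · rw [decompose_of_mem_ne 𝒟 x.2 h, decompose_of_mem_ne ℳ (hφ _ _ x.2) h, map_zero]
    | add x y hx hy =>
      simp only [decompose_add, DirectSum.add_apply, Submodule.coe_add, map_add, hx, hy]
  intro n x hx
  rw [LinearMap.mem_ker] at hx ⊢
  rw [key, hx]
  simp

/-- The homogeneous elements of a submodule, together with their degrees. -/
def HomogeneousElements (ℳ : ℕ → Submodule k M) (N : Submodule A M) : Type u :=
  {p : ULift.{u} ℕ × M // p.2 ∈ N ∧ p.2 ∈ ℳ p.1.down}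

/-- The map to `M` from the free module on the homogeneous elements of a submodule. -/
def coverMap (ℳ : ℕ → Submodule k M) (N : Submodule A M) :
    (HomogeneousElements ℳ N →₀ A) →ₗ[A] M :=
  Finsupp.linearCombination A fun p => p.1.2

theorem coverMap_mem (𝒜 : ℕ → Submodule k A) [GradedAlgebra 𝒜] (ℳ : ℕ → Submodule k M)
    [SetLike.GradedSMul 𝒜 ℳ] (N : Submodule A M) (n : ℕ) :
    ∀ x ∈ freeGrading 𝒜 (fun p : HomogeneousElements ℳ N => p.1.1.down) n,
      coverMap ℳ N x ∈ ℳ n :=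
  fun _ hx => linearCombination_mem _ ℳ _ (fun p => p.2.2) hx

theorem range_coverMap (ℳ : ℕ → Submodule k M) [Decomposition ℳ] (N : Submodule A M)
    (hN : N.IsHomogeneous ℳ) : LinearMap.range (coverMap ℳ N) = N := by
  classical
  rw [coverMap, Finsupp.range_linearCombination]
  apply le_antisymm
  · rw [Submodule.span_le]
    rintro _ ⟨p, rfl⟩
    exact p.2.1
  · intro x hx
    rw [← sum_support_decompose ℳ x]
    refine sum_mem fun n _ => Submodule.subset_span ?_
    exact ⟨⟨(⟨n⟩, _), hN n hx, (decompose ℳ x n).2⟩, rfl⟩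

/-- A graded free module with a homogeneous submodule that remains to be covered. -/
structure ResolutionStage (𝒜 : ℕ → Submodule k A) [GradedAlgebra 𝒜] where
  ι : Type u
  deg : ι → ℕ
  N : Submodule A (ι →₀ A)
  hN : N.IsHomogeneous (freeGrading 𝒜 deg)

/-- Cover the given submodule by a graded free module and pass to the kernel. -/
def ResolutionStage.next {𝒜 : ℕ → Submodule k A} [GradedAlgebra 𝒜] (S : ResolutionStage 𝒜) :
    ResolutionStage 𝒜 where
  ι := HomogeneousElements (freeGrading 𝒜 S.deg) S.N
  deg p := p.1.1.down
  N := LinearMap.ker (coverMap (freeGrading 𝒜 S.deg) S.N)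
  hN := isHomogeneous_ker _ _ _ (coverMap_mem 𝒜 _ S.N)

/-- The differential that covers the given submodule. -/
def ResolutionStage.map {𝒜 : ℕ → Submodule k A} [GradedAlgebra 𝒜] (S : ResolutionStage 𝒜) :
    (S.next.ι →₀ A) →ₗ[A] (S.ι →₀ A) :=
  coverMap (freeGrading 𝒜 S.deg) S.N

theorem ResolutionStage.range_map {𝒜 : ℕ → Submodule k A} [GradedAlgebra 𝒜]
    (S : ResolutionStage 𝒜) : LinearMap.range S.map = S.N :=
  range_coverMap _ _ S.hN

theorem ResolutionStage.exact_map {𝒜 : ℕ → Submodule k A} [GradedAlgebra 𝒜]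
    (S : ResolutionStage 𝒜) : Function.Exact S.next.map S.map :=
  LinearMap.exact_iff.mpr S.next.range_map.symm

/-- Every graded module has a graded free resolution. -/
theorem GradedFreeResolution.nonempty (𝒜 : ℕ → Submodule k A) [GradedAlgebra 𝒜]
    (ℳ : ℕ → Submodule k M) [Decomposition ℳ] [SetLike.GradedSMul 𝒜 ℳ] :
    Nonempty (GradedFreeResolution 𝒜 ℳ) := by
  let S₀ : ResolutionStage 𝒜 :=
    { ι := HomogeneousElements ℳ (⊤ : Submodule A M)
      deg := fun p => p.1.1.down
      N := LinearMap.ker (coverMap ℳ (⊤ : Submodule A M))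
      hN := isHomogeneous_ker _ _ _ (coverMap_mem 𝒜 ℳ _) }
  let S : ℕ → ResolutionStage 𝒜 := fun i => Nat.rec S₀ (fun _ T => T.next) i
  exact ⟨{
    F := fun i => (S i).ι →₀ A
    ι := fun i => (S i).ι
    basis := fun i => Finsupp.basisSingleOne
    deg := fun i => (S i).deg
    d := fun i => (S i).map
    aug := coverMap ℳ (⊤ : Submodule A M)
    d_mem := fun i n => coverMap_mem 𝒜 _ (S i).N n
    aug_mem := coverMap_mem 𝒜 ℳ _
    exact_d := fun i => (S i).exact_map
    exact_aug := LinearMap.exact_iff.mpr S₀.range_map.symm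
    aug_surjective := LinearMap.range_eq_top.mp (range_coverMap ℳ _ fun _ _ _ => trivial) }⟩

end Resolution

/-! ### Graded Tor -/

section Tor

variable {k : Type w} [CommRing k] {A M : Type u} [CommRing A] [Algebra k A]
variable [AddCommGroup M] [Module k M] [Module A M]

/-- The degree `n` part of `P ⊗[A] N`, spanned by the `x ⊗ y` with `x`, `y` homogeneous and
`deg x + deg y = n`. -/
def tensorGrading (A : Type u) [CommRing A] [Algebra k A] {P : Type u} [AddCommGroup P]
    [Module k P] [Module A P] [IsScalarTower k A P] {N : Type v} [AddCommGroup N] [Module k N]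
    [Module A N] (𝒟 : ℕ → Submodule k P) (𝒩 : ℕ → Submodule k N) (n : ℕ) :
    Submodule k (P ⊗[A] N) :=
  Submodule.span k {z | ∃ i j, i + j = n ∧ ∃ x ∈ 𝒟 i, ∃ y ∈ 𝒩 j, x ⊗ₜ[A] y = z}

namespace GradedFreeResolution

variable {𝒜 : ℕ → Submodule k A} {ℳ : ℕ → Submodule k M} (F : GradedFreeResolution 𝒜 ℳ)
variable {N : Type v} [AddCommGroup N] [Module k N] [Module A N] (𝒩 : ℕ → Submodule k N)

variable (N) in
/-- The cycles of the complex `F ⊗ N` in homological degree `i`. -/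
def cycles : ∀ i, Submodule A (F.F i ⊗[A] N)
  | 0 => ⊤
  | i + 1 => LinearMap.ker ((F.d i).rTensor N)

variable (N) in
/-- The boundaries of the complex `F ⊗ N` in homological degree `i`. -/
def boundaries (i : ℕ) : Submodule A (F.F i ⊗[A] N) :=
  LinearMap.range ((F.d i).rTensor N)

/-- The cycles of internal degree `n`. -/
def gradedCycles (i n : ℕ) : Submodule k (F.F i ⊗[A] N) :=
  (F.cycles N i).restrictScalars k ⊓ tensorGrading A (basisGrading 𝒜 (F.basis i) (F.deg i)) 𝒩 n

/-- The boundaries of internal degree `n`. -/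
def gradedBoundaries (i n : ℕ) : Submodule k (F.F i ⊗[A] N) :=
  (F.boundaries N i).restrictScalars k ⊓ tensorGrading A (basisGrading 𝒜 (F.basis i) (F.deg i)) 𝒩 n

/-- The degree `n` part of the homology `H_i(F ⊗ N)`. -/
abbrev Homology (i n : ℕ) : Type (max u v) :=
  F.gradedCycles 𝒩 i n ⧸ (F.gradedBoundaries 𝒩 i n).submoduleOf (F.gradedCycles 𝒩 i n)

end GradedFreeResolution

/-- The degree `n` part of the graded module `Tor_i^A(M, N)`, computed from a graded free
resolution of `M`. -/
abbrev GradedTor (𝒜 : ℕ → Submodule k A) [GradedAlgebra 𝒜] (ℳ : ℕ → Submodule k M)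
    [Decomposition ℳ] [SetLike.GradedSMul 𝒜 ℳ] {N : Type v} [AddCommGroup N] [Module k N]
    [Module A N] (𝒩 : ℕ → Submodule k N) (i n : ℕ) : Type (max u v) :=
  (GradedFreeResolution.nonempty 𝒜 ℳ).some.Homology 𝒩 i n

/-- `t_i^A(M)`, the end of the graded module `Tor_i^A(M, A ⧸ A₊)`. -/
def torEnd (𝒜 : ℕ → Submodule k A) [GradedAlgebra 𝒜] (ℳ : ℕ → Submodule k M)
    [Decomposition ℳ] [SetLike.GradedSMul 𝒜 ℳ] (i : ℕ) : EReal :=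
  gradedEnd fun n => GradedTor 𝒜 ℳ (residueGrading 𝒜) i n

end Tor

end

attribute [local instance] MvPolynomial.gradedAlgebra

/-! Write I = C₊B and e = end(B/I). If e is infinite the bounds are trivial, so let e be finite. Let
F be any graded free resolution of k over C, not necessarily minimal, and extend scalars to B. Let
Zᵢ be the cycles, Eᵢ the boundaries and Hᵢ = Zᵢ/Eᵢ the homology of the extended complex, so Hᵢ =
Torᵢ^C(k, B). Multiplication by an element of C₊ is null homotopic on F, so I annihilates Hᵢ. Hence
Hᵢ vanishes above degree τ + e as soon as it is generated in degrees at most τ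
(`GeneratedUpTo.mem_of_lt`).

Tor^B(-, k) is computed by the Koszul complex of the variables. The sequences 0 → Eᵢ → Zᵢ → Hᵢ → 0
and 0 → Zᵢ₊₁ → Fᵢ₊₁ ⊗ B → Eᵢ → 0 carry vanishing from Hᵢ and Zᵢ to Eᵢ and on to Zᵢ₊₁
(`KoszulVanishes.sub`, `KoszulVanishes.ker`). Moreover Tor₁^B(Eᵢ, k) is the kernel of Zᵢ₊₁ ⊗ k →
Fᵢ₊₁ ⊗ k, so it controls the minimal generators of Zᵢ₊₁ whose coordinates have positive degree. The
other generators of Hᵢ₊₁ are controlled by Torᵢ₊₁^C(k, k), thanks to the splitting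
(`generatedUpTo_succ`).

To pass to Torᵢ₊₂^C(k, k), suppose that above degree τ the elements of Z = Zᵢ₊₁ with coordinates of
positive degree are not minimal generators. Then above degree τ + e the elements of Z with
coordinates in I lie in IZ (`mem_ideal_smul_of_mem_coordIdeal`). This applies to the differential of
a cycle of F ⊗ k. The splitting sends IZ into C₊ times the cycles of F, and the given cycle is
therefore a boundary modulo C₊.

If Hᵢ vanishes above degree T, then Tor₂^B(Hᵢ, k) vanishes above T + 2, and this bounds the positive
generators of Zᵢ₊₁. With the e gained from generators to top degree, each step costs e + 2. Under
the additional hypothesis Tor₂^B(B/I, k) = Tor₁^B(I, k) vanishes in degree e + 2. The same holds in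
the extreme degree for any B/I-module generated in bounded degrees (`GeneratedUpTo.koszulVanishes`),
so each step costs only e + 1. -/

noncomputable section

/-! ### The Koszul complex of a sequence, as iterated mapping cones -/

section Koszul

/-- The index set of the basis of the `j`-th term of the Koszul complex on `r` elements. -/
def KoszulIndex : ℕ → ℕ → Type
  | 0, 0 => Unit
  | 0, _ + 1 => Empty
  | r + 1, 0 => KoszulIndex r 0
  | r + 1, j + 1 => KoszulIndex r (j + 1) ⊕ KoszulIndex r j

namespace KoszulIndex

/-- The generators that do not involve the last element, in homological degree `0`. -/
def base {r : ℕ} (s : KoszulIndex r 0) : KoszulIndex (r + 1) 0 := s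

/-- The generators that do not involve the last element. -/
def left {r j : ℕ} (s : KoszulIndex r (j + 1)) : KoszulIndex (r + 1) (j + 1) := Sum.inl s

/-- The generators that involve the last element. -/
def right {r j : ℕ} (s : KoszulIndex r j) : KoszulIndex (r + 1) (j + 1) := Sum.inr s

@[elab_as_elim]
theorem forall_zero {r : ℕ} {p : KoszulIndex (r + 1) 0 → Prop} (h : ∀ s, p (base s)) (s) : p s :=
  h s

@[elab_as_elim]
theorem forall_succ {r j : ℕ} {p : KoszulIndex (r + 1) (j + 1) → Prop} (h : ∀ s, p (left s))
    (h' : ∀ s, p (right s)) (s) : p s :=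
  match s with
  | .inl s => h s
  | .inr s => h' s

/-- A function on the generators from its two parts. -/
def glue {r j : ℕ} {M : Type*} (f : KoszulIndex r (j + 1) → M) (g : KoszulIndex r j → M) :
    KoszulIndex (r + 1) (j + 1) → M
  | .inl s => f s
  | .inr s => g s

end KoszulIndex

open KoszulIndex

variable {R : Type*} [CommRing R] (x : ℕ → R)
variable {M M' : Type*} [AddCommGroup M] [Module R M] [AddCommGroup M'] [Module R M']

/-- The Koszul differential on `x 0, …, x (r - 1)` with coefficients in `M`. -/
def koszulD : ∀ r j : ℕ, (KoszulIndex r (j + 1) → M) → KoszulIndex r j → M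
  | 0, _, _ => 0
  | r + 1, 0, f => fun s => koszulD r 0 (f ∘ left) s + x r • f (right s)
  -- The sign on the second part makes the two terms with `x r` cancel in the square of the
  -- differential.
  | r + 1, j + 1, f => glue (koszulD r (j + 1) (f ∘ left) + x r • (f ∘ right))
      (- koszulD r j (f ∘ right))

theorem koszulD_base (r : ℕ) (f : KoszulIndex (r + 1) 1 → M) (s : KoszulIndex r 0) :
    koszulD x (r + 1) 0 f (base s) = koszulD x r 0 (f ∘ left) s + x r • f (right s) := rfl

theorem koszulD_left (r j : ℕ) (f : KoszulIndex (r + 1) (j + 2) → M)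
    (s : KoszulIndex r (j + 1)) : koszulD x (r + 1) (j + 1) f (left s) =
      koszulD x r (j + 1) (f ∘ left) s + x r • f (right s) := rfl

theorem koszulD_right (r j : ℕ) (f : KoszulIndex (r + 1) (j + 2) → M) (s : KoszulIndex r j) :
    koszulD x (r + 1) (j + 1) f (right s) = - koszulD x r j (f ∘ right) s := rfl

/-- Naturality of the Koszul differential, in a form that covers maps that shift degree. -/
theorem koszulD_map (φ ψ : M →+ M') (h : ∀ i m, φ (x i • m) = x i • ψ m) :
    ∀ (r j : ℕ) (f : KoszulIndex r (j + 1) → M) (s),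
      φ (koszulD x r j f s) = koszulD x r j (ψ ∘ f) s
  | 0, _, _, _ => map_zero φ
  | r + 1, 0, f, s => by
    refine forall_zero (fun s => ?_) s
    rw [koszulD_base, koszulD_base, map_add, h, koszulD_map φ ψ h r 0]
    rfl
  | r + 1, j + 1, f, s => by
    refine forall_succ (fun s => ?_) (fun s => ?_) s
    · rw [koszulD_left, koszulD_left, map_add, h, koszulD_map φ ψ h r (j + 1)]
      rfl
    · rw [koszulD_right, koszulD_right, map_neg, koszulD_map φ ψ h r j]
      rfl

theorem koszulD_linearMap (φ : M →ₗ[R] M') (r j : ℕ) (f : KoszulIndex r (j + 1) → M) (s) :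
    φ (koszulD x r j f s) = koszulD x r j (φ ∘ f) s :=
  koszulD_map x φ.toAddMonoidHom φ.toAddMonoidHom (fun i m => φ.map_smul (x i) m) r j f s

theorem koszulD_smul (a : R) (r j : ℕ) (f : KoszulIndex r (j + 1) → M) (s) :
    koszulD x r j (a • f) s = a • koszulD x r j f s :=
  (koszulD_linearMap x (LinearMap.lsmul R M a) r j f s).symm

theorem koszulD_add : ∀ (r j : ℕ) (f g : KoszulIndex r (j + 1) → M),
    koszulD x r j (f + g) = koszulD x r j f + koszulD x r j g
  | 0, _, _, _ => (add_zero _).symm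
  | r + 1, 0, f, g => by
    funext s
    refine forall_zero (fun s => ?_) s
    have := congrFun (koszulD_add r 0 (f ∘ left) (g ∘ left)) s
    rw [Pi.add_apply, koszulD_base, koszulD_base, koszulD_base, Pi.add_apply, smul_add,
      add_add_add_comm, ← Pi.add_apply (koszulD x r 0 _), ← this]
    rfl
  | r + 1, j + 1, f, g => by
    funext s
    refine forall_succ (fun s => ?_) (fun s => ?_) s
    · have := congrFun (koszulD_add r (j + 1) (f ∘ left) (g ∘ left)) s
      rw [Pi.add_apply, koszulD_left, koszulD_left, koszulD_left, Pi.add_apply, smul_add,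
        add_add_add_comm, ← Pi.add_apply (koszulD x r (j + 1) _), ← this]
      rfl
    · have := congrFun (koszulD_add r j (f ∘ right) (g ∘ right)) s
      rw [Pi.add_apply, koszulD_right, koszulD_right, koszulD_right, ← neg_add,
        ← Pi.add_apply (koszulD x r j _), ← this]
      rfl

variable (M) in
/-- The Koszul differential as an additive map. -/
def koszulHom (r j : ℕ) : (KoszulIndex r (j + 1) → M) →+ (KoszulIndex r j → M) :=
  AddMonoidHom.mk' (koszulD x r j) (koszulD_add x r j)

theorem koszulD_zero (r j : ℕ) : koszulD x r j (0 : KoszulIndex r (j + 1) → M) = 0 :=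
  map_zero (koszulHom x M r j)

theorem koszulD_sub (r j : ℕ) (f g : KoszulIndex r (j + 1) → M) :
    koszulD x r j (f - g) = koszulD x r j f - koszulD x r j g :=
  map_sub (koszulHom x M r j) f g

theorem koszulD_neg (r j : ℕ) (f : KoszulIndex r (j + 1) → M) :
    koszulD x r j (-f) = - koszulD x r j f :=
  map_neg (koszulHom x M r j) f

theorem koszulD_mem (N : AddSubgroup M) :
    ∀ (r j : ℕ) (f : KoszulIndex r (j + 1) → M), (∀ i < r, ∀ s, x i • f s ∈ N) →
      ∀ s, koszulD x r j f s ∈ N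
  | 0, _, _, _, _ => zero_mem N
  | r + 1, 0, f, h, s => add_mem
      (koszulD_mem N r 0 _ (fun i hi t => h i (by omega) (left t)) s) (h r (by omega) (right s))
  | r + 1, j + 1, f, h, .inl s => add_mem
      (koszulD_mem N r (j + 1) _ (fun i hi t => h i (by omega) (left t)) s)
      (h r (by omega) (right s))
  | r + 1, j + 1, f, h, .inr s => neg_mem
      (koszulD_mem N r j _ (fun i hi t => h i (by omega) (right t)) s)

theorem koszulD_koszulD : ∀ (r j : ℕ) (f : KoszulIndex r (j + 2) → M),
    koszulD x r j (koszulD x r (j + 1) f) = 0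
  | 0, _, _ => rfl
  | r + 1, j, f => by
    have hl : koszulD x (r + 1) (j + 1) f ∘ left =
        koszulD x r (j + 1) (f ∘ left) + x r • (f ∘ right) := rfl
    have h2 (s : KoszulIndex r j) :
        koszulD x r j (koszulD x (r + 1) (j + 1) f ∘ left) s +
          x r • koszulD x (r + 1) (j + 1) f (right s) = 0 := by
      rw [hl, koszulD_add, koszulD_koszulD r j, koszulD_right, zero_add, koszulD_smul,
        smul_neg, add_neg_cancel]
    funext s
    cases j with
    | zero => exact forall_zero h2 s
    | succ j =>
      refine forall_succ h2 (fun s => ?_) s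
      have hr : koszulD x (r + 1) (j + 2) f ∘ right = - koszulD x r (j + 1) (f ∘ right) := rfl
      rw [koszulD_right, hr, koszulD_neg, koszulD_koszulD r j]
      simp

/-- The first Koszul homology detects regularity: exactness of the Koszul complex from its
exactness at the end.  Here `J r` plays the role of `(x 0, …, x (r - 1)) M`. -/
theorem koszul_exact (J : ℕ → Set M) (m : ℕ) (hJ0 : ∀ y ∈ J 0, y = 0)
    (hJ : ∀ r < m, ∀ y ∈ J (r + 1), ∃ q ∈ J r, ∃ p, y = q + x r • p) (r : ℕ) (hr : r ≤ m)
    (f : KoszulIndex r 0 → M) (hf : ∀ s, f s ∈ J r) : ∃ g, koszulD x r 0 g = f := by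
  induction r with
  | zero => exact ⟨0, by funext s; exact (hJ0 _ (hf s)).symm⟩
  | succ r ih =>
    choose q hq p hp using fun s => hJ r hr (f s) (hf s)
    obtain ⟨g, hg⟩ := ih (by omega) q hq
    refine ⟨glue g p, funext fun s => ?_⟩
    change koszulD x r 0 g s + x r • p s = f s
    rw [hg, hp s]

/-- Induction through the mapping cone. The part of a cycle that involves the last element bounds
some `b`: by induction in higher degree, and in lowest degree because `x r` is regular modulo `J r`.
Correcting the other part by `x r • b` leaves a cycle for the shorter sequence. -/
theorem koszul_exact_succ (J : ℕ → AddSubgroup M) (m : ℕ) (hJ0 : ∀ y ∈ J 0, y = 0)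
    (hJ : ∀ r < m, ∀ y ∈ J (r + 1), ∃ q ∈ J r, ∃ p, y = q + x r • p)
    (hreg : ∀ r < m, ∀ y, x r • y ∈ J r → y ∈ J r)
    (hmem : ∀ r ≤ m, ∀ i < r, ∀ y, x i • y ∈ J r) (r : ℕ) (hr : r ≤ m) :
    ∀ (j : ℕ) (f : KoszulIndex r (j + 1) → M), koszulD x r j f = 0 →
      ∃ g, koszulD x r (j + 1) g = f := by
  induction r with
  | zero => exact fun j f _ => ⟨0, funext fun s => s.elim⟩
  | succ r ih =>
    intro j f hf
    obtain ⟨b, hb⟩ : ∃ b, koszulD x r j b = f ∘ right := by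
      cases j with
      | zero =>
        refine koszul_exact x (fun r => J r) m hJ0 hJ r (by omega) _ fun s => ?_
        refine hreg r hr _ ?_
        have := congrFun hf (base s)
        rw [koszulD_base] at this
        rw [Function.comp_apply, eq_neg_of_add_eq_zero_right this]
        exact neg_mem (koszulD_mem x (J r) r 0 _
          (fun i hi t => hmem r (by omega) i hi _) s)
      | succ j =>
        refine ih (by omega) j _ (funext fun s => ?_)
        have := congrFun hf (right s)
        exact neg_eq_zero.mp this
    have key : koszulD x r j (f ∘ left + x r • b) = 0 := by
      funext s
      rw [koszulD_add, Pi.add_apply, koszulD_smul, hb]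
      cases j with
      | zero => exact congrFun hf (base s)
      | succ j => exact congrFun hf (left s)
    obtain ⟨a, ha⟩ := ih (by omega) j _ key
    refine ⟨glue a (-b), funext fun s => ?_⟩
    refine forall_succ (fun s => ?_) (fun s => ?_) s
    · change koszulD x r (j + 1) a s + x r • (- b s) = _
      rw [ha]
      simp
    · change - koszulD x r j (- b) s = _
      rw [koszulD_neg, hb]
      simp

instance koszulIndex_zero_nonempty : ∀ r, Nonempty (KoszulIndex r 0)
  | 0 => ⟨()⟩
  | r + 1 => koszulIndex_zero_nonempty r

instance koszulIndex_finite : ∀ r j, Finite (KoszulIndex r j)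
  | 0, 0 => inferInstanceAs (Finite Unit)
  | 0, _ + 1 => inferInstanceAs (Finite Empty)
  | r + 1, 0 => koszulIndex_finite r 0
  | r + 1, j + 1 =>
    have := koszulIndex_finite r (j + 1)
    have := koszulIndex_finite r j
    inferInstanceAs (Finite (KoszulIndex r (j + 1) ⊕ KoszulIndex r j))

end Koszul

/-! ### Homogeneous components -/

section Component

variable {k : Type*} [CommRing k] {M M' : Type*} [AddCommGroup M] [Module k M]
variable [AddCommGroup M'] [Module k M']

/-- The projection of a graded module to its degree `d` component. -/
def component (ℳ : ℕ → Submodule k M) [Decomposition ℳ] (d : ℕ) : M →+ M where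
  toFun m := decompose ℳ m d
  map_zero' := by simp
  map_add' x y := by simp

variable (ℳ : ℕ → Submodule k M) [Decomposition ℳ] (ℳ' : ℕ → Submodule k M') [Decomposition ℳ']

theorem component_mem (d : ℕ) (m : M) : component ℳ d m ∈ ℳ d := (decompose ℳ m d).2

theorem component_of_mem {d : ℕ} {m : M} (hm : m ∈ ℳ d) : component ℳ d m = m :=
  decompose_of_mem_same ℳ hm

theorem component_of_mem_ne {d d' : ℕ} {m : M} (hm : m ∈ ℳ d) (h : d ≠ d') :
    component ℳ d' m = 0 :=
  decompose_of_mem_ne ℳ hm h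

theorem map_component (φ : M →+ M') (j : ℕ) (hφ : ∀ n, ∀ x ∈ ℳ n, φ x ∈ ℳ' (j + n)) (d : ℕ)
    (x : M) : φ (component ℳ d x) = component ℳ' (j + d) (φ x) := by
  induction x using Decomposition.inductionOn ℳ with
  | zero => simp
  | @homogeneous i x =>
    by_cases h : i = d
    · subst h
      rw [component_of_mem ℳ x.2, component_of_mem ℳ' (hφ _ _ x.2)]
    · rw [component_of_mem_ne ℳ x.2 h, component_of_mem_ne ℳ' (hφ _ _ x.2) (by omega), map_zero]
  | add x y hx hy => simp only [map_add, hx, hy]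

theorem map_component_zero (φ : M →+ M') (hφ : ∀ n, ∀ x ∈ ℳ n, φ x ∈ ℳ' n) (d : ℕ) (x : M) :
    φ (component ℳ d x) = component ℳ' d (φ x) := by
  have := map_component ℳ ℳ' φ 0 (by simpa using hφ) d x
  rwa [zero_add] at this

variable {A : Type*} [CommRing A] [Module A M]

theorem component_smul [Algebra k A] (𝒜 : ℕ → Submodule k A) [SetLike.GradedSMul 𝒜 ℳ] {j : ℕ}
    {a : A} (ha : a ∈ 𝒜 j) (d : ℕ) (x : M) :
    component ℳ (j + d) (a • x) = a • component ℳ d x :=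
  (map_component ℳ ℳ (DistribSMul.toAddMonoidHom M a) j
    (fun _ _ hx => SetLike.GradedSMul.smul_mem ha hx) d x).symm

theorem isHomogeneous_bot : (⊥ : Submodule A M).IsHomogeneous ℳ := by
  intro d x hx
  rw [(Submodule.mem_bot A).mp hx]
  simp

theorem isHomogeneous_top : (⊤ : Submodule A M).IsHomogeneous ℳ := fun _ _ _ => trivial

theorem isHomogeneous_range [Module A M'] (φ : M →ₗ[A] M')
    (hφ : ∀ n, ∀ x ∈ ℳ n, φ x ∈ ℳ' n) : (LinearMap.range φ).IsHomogeneous ℳ' := by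
  rintro d _ ⟨x, rfl⟩
  exact ⟨component ℳ d x, map_component_zero ℳ ℳ' φ.toAddMonoidHom hφ d x⟩

/-- A homogeneous element of the range of a graded map is the image of a homogeneous element. -/
theorem exists_mem_of_mem_range [Module A M'] (φ : M →ₗ[A] M')
    (hφ : ∀ n, ∀ x ∈ ℳ n, φ x ∈ ℳ' n) {d : ℕ} {y : M'} (hy : y ∈ LinearMap.range φ)
    (hyd : y ∈ ℳ' d) : ∃ x ∈ ℳ d, φ x = y := by
  obtain ⟨x, rfl⟩ := hy
  refine ⟨component ℳ d x, component_mem ℳ d x, ?_⟩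
  rw [← component_of_mem ℳ' hyd]
  exact map_component_zero ℳ ℳ' φ.toAddMonoidHom hφ d x

end Component

/-! ### Coordinatewise ideals in free modules -/

section CoordIdeal

variable {A : Type*} [CommRing A]

/-- The elements of a free module all of whose coordinates lie in the ideal `J`. -/
def coordIdeal (J : Ideal A) (ι : Type*) : Submodule A (ι →₀ A) where
  carrier := {x | ∀ c, x c ∈ J}
  add_mem' hx hy c := add_mem (hx c) (hy c)
  zero_mem' _ := zero_mem _
  smul_mem' r _ hx c := J.mul_mem_left r (hx c)

theorem coordIdeal_eq_smul_top (J : Ideal A) (ι : Type*) :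
    coordIdeal J ι = J • (⊤ : Submodule A (ι →₀ A)) := by
  apply le_antisymm
  · intro x hx
    rw [← Finsupp.sum_single x]
    refine sum_mem fun c _ => ?_
    rw [← mul_one (x c), ← smul_eq_mul, ← Finsupp.smul_single]
    exact Submodule.smul_mem_smul (hx c) trivial
  · rw [Submodule.smul_le]
    exact fun a ha x _ c => J.mul_mem_right _ ha

theorem map_mem_coordIdeal {ι ι' : Type*} (J : Ideal A) (φ : (ι →₀ A) →ₗ[A] (ι' →₀ A)) {x}
    (hx : x ∈ coordIdeal J ι) : φ x ∈ coordIdeal J ι' := by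
  rw [coordIdeal_eq_smul_top] at hx ⊢
  have : φ x ∈ (J • (⊤ : Submodule A (ι →₀ A))).map φ := ⟨x, hx, rfl⟩
  rw [Submodule.map_smul''] at this
  exact Submodule.smul_mono le_rfl le_top this

end CoordIdeal

/-! ### The Koszul complex of the variables -/

section Polynomial

open MvPolynomial

variable {n : ℕ} {k : Type u} [Field k]

/-- The sequence of variables, continued by zero. -/
def varSeq (n : ℕ) (k : Type u) [Field k] (r : ℕ) : MvPolynomial (Fin n) k :=
  if h : r < n then X ⟨r, h⟩ else 0

theorem varSeq_mem (r : ℕ) : varSeq n k r ∈ homogeneousSubmodule (Fin n) k 1 := by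
  unfold varSeq
  split_ifs with h
  · exact isHomogeneous_X k _
  · exact zero_mem _

theorem mem_irrelevant_iff_coeff (p : MvPolynomial (Fin n) k) :
    p ∈ (HomogeneousIdeal.irrelevant (homogeneousSubmodule (Fin n) k)).toIdeal ↔
      coeff 0 p = 0 := by
  change p ∈ HomogeneousIdeal.irrelevant (homogeneousSubmodule (Fin n) k) ↔ _
  rw [HomogeneousIdeal.mem_irrelevant_iff]
  have : GradedRing.proj (homogeneousSubmodule (Fin n) k) 0 p = homogeneousComponent 0 p :=
    decomposition.decompose'_apply p 0
  rw [this, homogeneousComponent_zero, C_eq_zero]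

/-- The elements of a free module whose coordinates are sums of monomials that involve one of the
first `r` variables. -/
def varSpan (ι : Type*) (r : ℕ) : AddSubgroup (ι →₀ MvPolynomial (Fin n) k) where
  carrier := {y | ∀ c m, (∀ i : Fin n, (i : ℕ) < r → m i = 0) → coeff m (y c) = 0}
  add_mem' hx hy c m hm := by simp [hx c m hm, hy c m hm]
  zero_mem' c m _ := by simp
  neg_mem' hx c m hm := by simp [hx c m hm]

variable {ι : Type*}

theorem eq_zero_of_mem_varSpan_zero (y : ι →₀ MvPolynomial (Fin n) k)
    (hy : y ∈ varSpan ι 0) : y = 0 :=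
  Finsupp.ext fun c => MvPolynomial.ext _ _ fun m => by simpa using hy c m (by simp)

/-- Coordinatewise division by the variable of index `r`: the monomials of the remainder avoid it,
so they involve an earlier variable. -/
theorem exists_of_mem_varSpan_succ (r : ℕ) (hr : r < n) (y : ι →₀ MvPolynomial (Fin n) k)
    (hy : y ∈ varSpan ι (r + 1)) : ∃ q ∈ varSpan (n := n) (k := k) ι r, ∃ p,
      y = q + varSeq n k r • p := by
  refine ⟨y.mapRange (fun p => p.modMonomial (Finsupp.single ⟨r, hr⟩ 1)) ?_, ?_,
    y.mapRange (fun p => p.divMonomial (Finsupp.single ⟨r, hr⟩ 1)) ?_, ?_⟩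
  · ext m
    by_cases h : Finsupp.single ⟨r, hr⟩ 1 ≤ m
    · rw [coeff_modMonomial_of_le _ h, coeff_zero]
    · rw [coeff_modMonomial_of_not_le _ h]
  · intro c m hm
    rw [Finsupp.mapRange_apply]
    by_cases h : Finsupp.single ⟨r, hr⟩ 1 ≤ m
    · rw [coeff_modMonomial_of_le _ h]
    · rw [coeff_modMonomial_of_not_le _ h]
      refine hy c m fun i hi => ?_
      rcases Nat.lt_succ_iff_lt_or_eq.mp hi with hi | hi
      · exact hm i hi
      · obtain rfl : i = ⟨r, hr⟩ := Fin.ext hi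
        by_contra h0
        exact h (Finsupp.single_le_iff.mpr (Nat.one_le_iff_ne_zero.mpr h0))
  · exact zero_divMonomial _
  · ext1 c
    simp only [varSeq, hr, dif_pos, Finsupp.add_apply, Finsupp.mapRange_apply,
      Finsupp.smul_apply, smul_eq_mul]
    exact (modMonomial_add_divMonomial_single (y c) ⟨r, hr⟩).symm

/-- Multiplication by the variable of index `r` shifts only an exponent that membership in `varSpan
ι r` does not test. -/
theorem mem_varSpan_of_smul (r : ℕ) (hr : r < n) (y : ι →₀ MvPolynomial (Fin n) k)
    (hy : varSeq n k r • y ∈ varSpan ι r) : y ∈ varSpan ι r := by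
  intro c m hm
  have := hy c (Finsupp.single ⟨r, hr⟩ 1 + m) fun i hi => by
    have : (⟨r, hr⟩ : Fin n) ≠ i := by
      rintro rfl
      exact lt_irrefl _ hi
    simp [Finsupp.single_eq_of_ne' this, hm i hi]
  simpa only [varSeq, hr, dif_pos, Finsupp.smul_apply, smul_eq_mul, coeff_X_mul] using this

theorem smul_mem_varSpan (r i : ℕ) (hi : i < r) (y : ι →₀ MvPolynomial (Fin n) k) :
    varSeq n k i • y ∈ varSpan ι r := by
  intro c m hm
  unfold varSeq
  split_ifs with h
  · rw [Finsupp.smul_apply, smul_eq_mul, coeff_X_mul', if_neg]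
    simpa using hm ⟨i, h⟩ hi
  · simp

/-- With all `n` variables, `varSpan` tests only constant coefficients, so it is B₊ times the free
module. -/
theorem koszul_exact_free_zero (f : KoszulIndex n 0 → (ι →₀ MvPolynomial (Fin n) k))
    (hf : ∀ s, f s ∈ coordIdeal (HomogeneousIdeal.irrelevant
      (homogeneousSubmodule (Fin n) k)).toIdeal ι) :
    ∃ g, koszulD (varSeq n k) n 0 g = f := by
  have h (s) : f s ∈ varSpan ι n := fun c m hm => by
    obtain rfl : m = 0 := Finsupp.ext fun i => hm i i.2
    exact (mem_irrelevant_iff_coeff _).mp (hf s c)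
  exact koszul_exact (varSeq n k) (fun r => (varSpan (n := n) (k := k) ι r : Set _)) n
    eq_zero_of_mem_varSpan_zero exists_of_mem_varSpan_succ n le_rfl f h

theorem koszul_exact_free (j : ℕ) (f : KoszulIndex n (j + 1) → (ι →₀ MvPolynomial (Fin n) k))
    (hf : koszulD (varSeq n k) n j f = 0) : ∃ g, koszulD (varSeq n k) n (j + 1) g = f :=
  koszul_exact_succ (varSeq n k) (varSpan ι) n eq_zero_of_mem_varSpan_zero
    exists_of_mem_varSpan_succ mem_varSpan_of_smul (fun r _ => smul_mem_varSpan r)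
    n le_rfl j f hf

end Polynomial

/-! ### Vanishing of Koszul homology in given degrees -/

section Vanishing

open MvPolynomial

variable {n : ℕ} {k : Type u} [Field k]
variable {M : Type*} [AddCommGroup M] [Module k M] [Module (MvPolynomial (Fin n) k) M]
variable (ℳ : ℕ → Submodule k M)

/-- For homogeneous submodules `N ≤ Z`, the vanishing of the Koszul homology of `Z ⧸ N` in
homological degree `j + 1` and with coefficients of degree `a + 1`. -/
def KoszulVanishes (Z N : Submodule (MvPolynomial (Fin n) k) M) (j a : ℕ) : Prop :=
  ∀ f : KoszulIndex n (j + 1) → M, (∀ s, f s ∈ Z) → (∀ s, f s ∈ ℳ (a + 1)) →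
    (∀ s, koszulD (varSeq n k) n j f s ∈ N) →
    ∃ g : KoszulIndex n (j + 2) → M, (∀ s, g s ∈ Z) ∧
      ∀ s, f s - koszulD (varSeq n k) n (j + 1) g s ∈ N

variable {ℳ}

omit [Module k M] in
theorem koszulD_mem_irrelevant_smul (Z : Submodule (MvPolynomial (Fin n) k) M) {j : ℕ}
    {f : KoszulIndex n (j + 1) → M} (hf : ∀ s, f s ∈ Z) (s) :
    koszulD (varSeq n k) n j f s ∈
      (HomogeneousIdeal.irrelevant (homogeneousSubmodule (Fin n) k)).toIdeal • Z := by
  refine koszulD_mem (varSeq n k) ((HomogeneousIdeal.irrelevant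
    (homogeneousSubmodule (Fin n) k)).toIdeal • Z).toAddSubgroup n j f (fun i _ s => ?_) s
  refine Submodule.smul_mem_smul ?_ (hf s)
  rw [mem_irrelevant_iff_coeff]
  exact IsHomogeneous.coeff_eq_zero (varSeq_mem i) (by simp)

theorem koszulD_mem_grading [SetLike.GradedSMul (homogeneousSubmodule (Fin n) k) ℳ] {j a : ℕ}
    {f : KoszulIndex n (j + 1) → M} (hf : ∀ s, f s ∈ ℳ a) (s) :
    koszulD (varSeq n k) n j f s ∈ ℳ (a + 1) := by
  refine koszulD_mem (varSeq n k) (ℳ (a + 1)).toAddSubgroup n j f (fun i _ s => ?_) s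
  rw [add_comm]
  exact SetLike.GradedSMul.smul_mem (varSeq_mem i) (hf s)

theorem koszulVanishes_of_le {Z N : Submodule (MvPolynomial (Fin n) k) M} {a : ℕ}
    (h : ∀ z ∈ Z, z ∈ ℳ (a + 1) → z ∈ N) (j : ℕ) : KoszulVanishes ℳ Z N j a := by
  refine fun f hf hfa _ => ⟨0, fun _ => zero_mem _, fun s => ?_⟩
  rw [koszulD_zero]
  simpa using h _ (hf s) (hfa s)

variable [Decomposition ℳ] [SetLike.GradedSMul (homogeneousSubmodule (Fin n) k) ℳ]

/-- A Koszul primitive modulo `N` of a homogeneous chain may be chosen homogeneous. -/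
theorem exists_homogeneous_primitive {Z N : Submodule (MvPolynomial (Fin n) k) M}
    (hZ : Z.IsHomogeneous ℳ) (hN : N.IsHomogeneous ℳ) {j a : ℕ} {f : KoszulIndex n j → M}
    (hf : ∀ s, f s ∈ ℳ (a + 1)) {g : KoszulIndex n (j + 1) → M} (hg : ∀ s, g s ∈ Z)
    (h : ∀ s, f s - koszulD (varSeq n k) n j g s ∈ N) :
    ∃ g' : KoszulIndex n (j + 1) → M, (∀ s, g' s ∈ Z) ∧ (∀ s, g' s ∈ ℳ a) ∧
      ∀ s, f s - koszulD (varSeq n k) n j g' s ∈ N := by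
  -- The Koszul differential raises the degree of coefficients by one, so the degree `a` part of `g`
  -- is the relevant one.
  refine ⟨component ℳ a ∘ g, fun s => hZ a (hg s), fun s => component_mem ℳ a _, fun s => ?_⟩
  have h1 := koszulD_map (varSeq n k) (component ℳ (1 + a)) (component ℳ a)
    (fun i m => component_smul ℳ (homogeneousSubmodule (Fin n) k) (varSeq_mem i) a m) n j g s
  rw [← h1, ← component_of_mem ℳ (hf s), add_comm a 1, ← map_sub]
  exact hN _ (h s)

theorem exists_homogeneous_primitive_eq {Z : Submodule (MvPolynomial (Fin n) k) M}
    (hZ : Z.IsHomogeneous ℳ) {j a : ℕ} {f : KoszulIndex n j → M}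
    (hf : ∀ s, f s ∈ ℳ (a + 1)) {g : KoszulIndex n (j + 1) → M} (hg : ∀ s, g s ∈ Z)
    (h : koszulD (varSeq n k) n j g = f) :
    ∃ g' : KoszulIndex n (j + 1) → M, (∀ s, g' s ∈ Z) ∧ (∀ s, g' s ∈ ℳ a) ∧
      koszulD (varSeq n k) n j g' = f := by
  obtain ⟨g', h1, h2, h3⟩ := exists_homogeneous_primitive hZ (isHomogeneous_bot ℳ) hf hg
    (fun s => by rw [h, sub_self]; exact zero_mem _)
  exact ⟨g', h1, h2, funext fun s => (sub_eq_zero.mp (h3 s)).symm⟩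

/-- The part `Tor_{j+2}(Z ⧸ N) → Tor_{j+1}(N) → Tor_{j+1}(Z)` of the long exact sequence. -/
theorem KoszulVanishes.sub {Z N : Submodule (MvPolynomial (Fin n) k) M}
    (hZ : Z.IsHomogeneous ℳ) (hNZ : N ≤ Z) {j a : ℕ}
    (h : KoszulVanishes ℳ Z ⊥ j (a + 1)) (h' : KoszulVanishes ℳ Z N (j + 1) a) :
    KoszulVanishes ℳ N ⊥ j (a + 1) := by
  intro f hf hfa hf0
  obtain ⟨g, hg, hfg⟩ := h f (fun s => hNZ (hf s)) hfa hf0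
  obtain ⟨g, hg, hga, hfg⟩ := exists_homogeneous_primitive hZ (isHomogeneous_bot ℳ) hfa hg hfg
  -- The connecting map: `g` is a cycle modulo `N`, and subtracting the boundary of a primitive
  -- modulo `N` moves it into `N` without changing its own boundary.
  obtain ⟨p, hp, hgp⟩ := h' g hg hga fun s => by
    have : koszulD (varSeq n k) n (j + 1) g s = f s :=
      (sub_eq_zero.mp ((Submodule.mem_bot _).mp (hfg s))).symm
    rw [this]
    exact hf s
  refine ⟨g - koszulD (varSeq n k) n (j + 2) p, hgp, fun s => ?_⟩
  rw [koszulD_sub, koszulD_koszulD, sub_zero]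
  exact hfg s

/-! ### Koszul homology of kernels and ranges of graded maps of free modules. -/

section Free

variable {ι ι' : Type u} {deg : ι → ℕ} {deg' : ι' → ℕ}

theorem koszulVanishes_free (ℳ : ℕ → Submodule k (ι →₀ MvPolynomial (Fin n) k)) (j a : ℕ) :
    KoszulVanishes ℳ (⊤ : Submodule (MvPolynomial (Fin n) k) (ι →₀ MvPolynomial (Fin n) k)) ⊥
      j a := by
  intro f _ _ hf
  obtain ⟨g, hg⟩ := koszul_exact_free j f (funext fun s => (Submodule.mem_bot _).mp (hf s))
  exact ⟨g, fun _ => trivial, fun s => by rw [hg, sub_self]; exact zero_mem _⟩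

/-- Exactness on the free module forces a 1-cycle to be the boundary of the empty chain, which has
values in any submodule. -/
theorem koszulVanishes_zero_of_isEmpty [IsEmpty (KoszulIndex n 2)]
    (ℳ : ℕ → Submodule k (ι →₀ MvPolynomial (Fin n) k))
    (N : Submodule (MvPolynomial (Fin n) k) (ι →₀ MvPolynomial (Fin n) k)) (a : ℕ) :
    KoszulVanishes ℳ N ⊥ 0 a := by
  intro f _ _ hf
  obtain ⟨g, hg⟩ := koszul_exact_free 0 f (funext fun s => (Submodule.mem_bot _).mp (hf s))
  exact ⟨g, fun s => isEmptyElim s, fun s => by rw [hg, sub_self]; exact zero_mem _⟩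

variable (D : (ι →₀ MvPolynomial (Fin n) k) →ₗ[MvPolynomial (Fin n) k]
    (ι' →₀ MvPolynomial (Fin n) k))
  (hD : ∀ d, ∀ x ∈ freeGrading (homogeneousSubmodule (Fin n) k) deg d,
    D x ∈ freeGrading (homogeneousSubmodule (Fin n) k) deg' d)

include hD in
/-- Chasing a homogeneous boundary of the free module that is annihilated by `D`. -/
theorem exists_primitive_mem_ker {j a : ℕ} {f : KoszulIndex n j → (ι →₀ MvPolynomial (Fin n) k)}
    (hf : ∀ s, D (f s) = 0)
    (hfa : ∀ s, f s ∈ freeGrading (homogeneousSubmodule (Fin n) k) deg (a + 2))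
    {g : KoszulIndex n (j + 1) → (ι →₀ MvPolynomial (Fin n) k)}
    (hg : koszulD (varSeq n k) n j g = f)
    (h : KoszulVanishes (freeGrading (homogeneousSubmodule (Fin n) k) deg')
      (LinearMap.range D) ⊥ j a) :
    ∃ g' : KoszulIndex n (j + 1) → (ι →₀ MvPolynomial (Fin n) k),
      (∀ s, g' s ∈ LinearMap.ker D) ∧ koszulD (varSeq n k) n j g' = f := by
  obtain ⟨g, -, hga, hfg⟩ := exists_homogeneous_primitive_eq
    (isHomogeneous_top (A := MvPolynomial (Fin n) k) _) hfa (fun _ => trivial) hg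
  -- `D ∘ g` is a Koszul cycle in the range of `D`, so it bounds some `p = D ∘ q`. Subtracting the
  -- boundary of `q` from `g` moves `g` into the kernel.
  obtain ⟨p, hp, hgp⟩ := h (D ∘ g) (fun s => ⟨_, rfl⟩) (fun s => hD _ _ (hga s)) fun s => by
    rw [← koszulD_linearMap, hfg]
    exact hf s
  choose q hq using hp
  refine ⟨g - koszulD (varSeq n k) n (j + 1) q, fun s => ?_, ?_⟩
  · have : D (koszulD (varSeq n k) n (j + 1) q s) = koszulD (varSeq n k) n (j + 1) p s := by
      rw [koszulD_linearMap]
      congr 1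
      exact funext hq
    rw [LinearMap.mem_ker, Pi.sub_apply, map_sub, this]
    exact hgp s
  · rw [koszulD_sub, koszulD_koszulD, sub_zero, hfg]

include hD in
-- The map Tor_{j+2}(range D) → Tor_{j+1}(ker D) is onto because the free module has no higher Tor.
-- The total degree is kept: the homological index drops by one and the coefficient degree rises by
-- one.
theorem KoszulVanishes.ker {j a : ℕ}
    (h : KoszulVanishes (freeGrading (homogeneousSubmodule (Fin n) k) deg')
      (LinearMap.range D) ⊥ (j + 1) a) :
    KoszulVanishes (freeGrading (homogeneousSubmodule (Fin n) k) deg)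
      (LinearMap.ker D) ⊥ j (a + 1) := by
  intro f hf hfa hf0
  obtain ⟨g, hg⟩ := koszul_exact_free j f (funext fun s => (Submodule.mem_bot _).mp (hf0 s))
  obtain ⟨g, hg, hfg⟩ := exists_primitive_mem_ker D hD hf hfa hg h
  exact ⟨g, hg, fun s => by rw [hfg, sub_self]; exact zero_mem _⟩

end Free

/-! ### Generation in bounded degrees -/

variable (ℳ) in
/-- The sums of products of a form of degree `m` and an element of `Z` of degree `a`. -/
def mulSpan (Z : Submodule (MvPolynomial (Fin n) k) M) (m a : ℕ) : AddSubgroup M :=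
  AddSubgroup.closure {y | ∃ b ∈ homogeneousSubmodule (Fin n) k m, ∃ z ∈ Z, z ∈ ℳ a ∧ b • z = y}

omit [Decomposition ℳ] [SetLike.GradedSMul (homogeneousSubmodule (Fin n) k) ℳ] in
theorem smul_mem_mulSpan {Z : Submodule (MvPolynomial (Fin n) k) M} {m m' a : ℕ}
    {b : MvPolynomial (Fin n) k} (hb : b ∈ homogeneousSubmodule (Fin n) k m') {y : M}
    (hy : y ∈ mulSpan ℳ Z m a) : b • y ∈ mulSpan ℳ Z (m' + m) a := by
  induction hy using AddSubgroup.closure_induction with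
  | mem y hy =>
    obtain ⟨c, hc, z, hz, hza, rfl⟩ := hy
    exact AddSubgroup.subset_closure ⟨b * c, SetLike.GradedMul.mul_mem hb hc, z, hz, hza,
      mul_smul b c z⟩
  | zero => simp
  | add x y _ _ hx hy => rw [smul_add]; exact add_mem hx hy
  | neg x _ hx => rw [smul_neg]; exact neg_mem hx

omit [Decomposition ℳ] [SetLike.GradedSMul (homogeneousSubmodule (Fin n) k) ℳ] in
theorem mulSpan_le_smul {Z : Submodule (MvPolynomial (Fin n) k) M}
    {I : Ideal (MvPolynomial (Fin n) k)} {m : ℕ}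
    (hI : ∀ b ∈ homogeneousSubmodule (Fin n) k m, b ∈ I) (a : ℕ) :
    mulSpan ℳ Z m a ≤ (I • Z).toAddSubgroup := by
  rw [mulSpan, AddSubgroup.closure_le]
  rintro _ ⟨b, hb, z, hz, -, rfl⟩
  exact Submodule.smul_mem_smul (hI b hb) hz

omit [Decomposition ℳ] [SetLike.GradedSMul (homogeneousSubmodule (Fin n) k) ℳ] in
theorem koszulD_mem_mulSpan {Z : Submodule (MvPolynomial (Fin n) k) M} {j a : ℕ}
    {f : KoszulIndex n (j + 1) → M} (hf : ∀ s, f s ∈ Z) (hfa : ∀ s, f s ∈ ℳ a) (s) :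
    koszulD (varSeq n k) n j f s ∈ mulSpan ℳ Z 1 a :=
  koszulD_mem (varSeq n k) (mulSpan ℳ Z 1 a) n j f
    (fun i _ s => AddSubgroup.subset_closure ⟨_, varSeq_mem i, _, hf s, hfa s, rfl⟩) s

variable (ℳ) in
/-- The module `Z ⧸ N` is generated in degrees at most `τ`. -/
def GeneratedUpTo (Z N : Submodule (MvPolynomial (Fin n) k) M) (τ : ℕ) : Prop :=
  ∀ a, τ ≤ a → ∀ z ∈ Z, z ∈ ℳ (a + 1) → z ∈ N.toAddSubgroup ⊔ mulSpan ℳ Z 1 a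

omit [Decomposition ℳ] [SetLike.GradedSMul (homogeneousSubmodule (Fin n) k) ℳ] in
-- Iterates the one-step condition down to elements of degree exactly `τ`, so that the coefficients
-- become forms of degree `m`.
theorem GeneratedUpTo.mem_sup {Z N : Submodule (MvPolynomial (Fin n) k) M} {τ : ℕ}
    (h : GeneratedUpTo ℳ Z N τ) (m : ℕ) :
    ∀ z ∈ Z, z ∈ ℳ (τ + m) → z ∈ N.toAddSubgroup ⊔ mulSpan ℳ Z m τ := by
  induction m with
  | zero =>
    intro z hz hza
    refine AddSubgroup.mem_sup_right (AddSubgroup.subset_closure ⟨1, ?_, z, hz, hza, one_smul _ z⟩)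
    exact isHomogeneous_one _ _
  | succ m ih =>
    intro z hz hza
    have key : mulSpan ℳ Z 1 (τ + m) ≤ N.toAddSubgroup ⊔ mulSpan ℳ Z (m + 1) τ := by
      rw [mulSpan, AddSubgroup.closure_le]
      rintro _ ⟨b, hb, y, hy, hya, rfl⟩
      obtain ⟨ν, hν, w, hw, rfl⟩ := AddSubgroup.mem_sup.mp (ih y hy hya)
      rw [smul_add]
      refine add_mem (AddSubgroup.mem_sup_left (N.smul_mem b hν)) (AddSubgroup.mem_sup_right ?_)
      rw [add_comm m 1]
      exact smul_mem_mulSpan hb hw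
    exact sup_le le_sup_left key (h (τ + m) (by omega) z hz hza)

omit [Decomposition ℳ] [SetLike.GradedSMul (homogeneousSubmodule (Fin n) k) ℳ] in
-- In degree `τ + m` with `m > e` the coefficients of the generators are forms of degree `m`, hence
-- lie in `I`, which carries `Z` into `N`.
theorem GeneratedUpTo.mem_of_lt {Z N : Submodule (MvPolynomial (Fin n) k) M} {τ e : ℕ}
    (h : GeneratedUpTo ℳ Z N τ) {I : Ideal (MvPolynomial (Fin n) k)} (hIZ : I • Z ≤ N)
    (hI : ∀ m, e < m → ∀ b ∈ homogeneousSubmodule (Fin n) k m, b ∈ I) {a : ℕ} (ha : τ + e < a) :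
    ∀ z ∈ Z, z ∈ ℳ a → z ∈ N := by
  intro z hz hza
  obtain ⟨m, rfl⟩ := Nat.exists_eq_add_of_le (show τ ≤ a by omega)
  have := h.mem_sup m z hz hza
  rwa [sup_eq_left.mpr ((mulSpan_le_smul (hI m (by omega)) τ).trans hIZ)] at this

omit [Decomposition ℳ] [SetLike.GradedSMul (homogeneousSubmodule (Fin n) k) ℳ] in
/-- If the second Koszul homology of `B ⧸ I` vanishes in the top degree, so does that of a module
over `B ⧸ I`. -/
theorem GeneratedUpTo.koszulVanishes {Z N : Submodule (MvPolynomial (Fin n) k) M} {τ e a : ℕ}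
    (h : GeneratedUpTo ℳ Z N τ) {I : Ideal (MvPolynomial (Fin n) k)} (hIZ : I • Z ≤ N)
    (hV : ∀ f : KoszulIndex n 2 → MvPolynomial (Fin n) k,
      (∀ s, f s ∈ homogeneousSubmodule (Fin n) k e) →
      ∃ g : KoszulIndex n 3 → MvPolynomial (Fin n) k,
        ∀ s, f s - koszulD (varSeq n k) n 2 g s ∈ I)
    (ha : a + 1 = τ + e) : KoszulVanishes ℳ Z N 1 a := by
  classical
  have : Fintype (KoszulIndex n 2) := Fintype.ofFinite _
  -- `Q` is additive, so it suffices to treat chains with a single value `b • z`, where `b` is a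
  -- form of degree `e` and `z` has degree `τ`. There a primitive modulo `I` of the chain with value
  -- `b` is multiplied by `z`.
  let Q (f : KoszulIndex n 2 → M) : Prop := ∃ g : KoszulIndex n 3 → M, (∀ s, g s ∈ Z) ∧
    ∀ s, f s - koszulD (varSeq n k) n 2 g s ∈ N
  have hQN : ∀ f : KoszulIndex n 2 → M, (∀ s, f s ∈ N) → Q f := fun f hf =>
    ⟨0, fun _ => zero_mem _, fun s => by simpa [koszulD_zero] using hf s⟩
  have hQadd : ∀ f f', Q f → Q f' → Q (f + f') := by
    rintro f f' ⟨g, hg, hfg⟩ ⟨g', hg', hfg'⟩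
    refine ⟨g + g', fun s => add_mem (hg s) (hg' s), fun s => ?_⟩
    rw [koszulD_add, Pi.add_apply, Pi.add_apply, add_sub_add_comm]
    exact add_mem (hfg s) (hfg' s)
  have hQneg : ∀ f, Q f → Q (-f) := by
    rintro f ⟨g, hg, hfg⟩
    refine ⟨-g, fun s => neg_mem (hg s), fun s => ?_⟩
    rw [koszulD_neg, Pi.neg_apply, Pi.neg_apply, ← neg_sub']
    exact neg_mem (hfg s)
  have hQsingle : ∀ s, ∀ y ∈ mulSpan ℳ Z e τ, Q (Pi.single s y) := by
    intro s y hy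
    induction hy using AddSubgroup.closure_induction with
    | mem y hy =>
      obtain ⟨b, hb, z, hz, -, rfl⟩ := hy
      obtain ⟨g, hg⟩ := hV (Pi.single s b) fun t => by
        by_cases hst : t = s
        · subst hst
          simpa using hb
        · rw [Pi.single_eq_of_ne hst]
          exact zero_mem _
      have hsingle (t) : (Pi.single s (b • z) : KoszulIndex n 2 → M) t =
          (Pi.single s b : KoszulIndex n 2 → MvPolynomial (Fin n) k) t • z := by
        by_cases hst : t = s
        · subst hst
          simp
        · simp [Pi.single_eq_of_ne hst]
      refine ⟨fun t => g t • z, fun t => Z.smul_mem _ hz, fun t => hIZ ?_⟩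
      have hnat := koszulD_linearMap (varSeq n k)
        (LinearMap.toSpanSingleton (MvPolynomial (Fin n) k) M z) n 2 g t
      change koszulD (varSeq n k) n 2 g t • z = koszulD (varSeq n k) n 2 (fun t => g t • z) t
        at hnat
      rw [← hnat, hsingle, ← sub_smul]
      exact Submodule.smul_mem_smul (hg t) hz
    | zero => rw [Pi.single_zero]; exact hQN 0 fun _ => zero_mem _
    | add x y _ _ hx hy => rw [Pi.single_add]; exact hQadd _ _ hx hy
    | neg x _ hx => rw [Pi.single_neg]; exact hQneg _ hx
  intro f hf hfa _
  change Q f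
  rw [← Finset.univ_sum_single f]
  refine Finset.sum_induction _ Q hQadd (hQN 0 fun _ => zero_mem _) fun s _ => ?_
  have hs := h.mem_sup e (f s) (hf s) (ha ▸ hfa s)
  obtain ⟨ν, hν, w, hw, hνw⟩ := AddSubgroup.mem_sup.mp hs
  rw [← hνw, Pi.single_add]
  refine hQadd _ _ (hQN _ fun t => ?_) (hQsingle s w hw)
  by_cases hst : t = s
  · subst hst
    simpa using hν
  · rw [Pi.single_eq_of_ne hst]
    exact zero_mem _

end Vanishing

/-! ### Graded Tor with the residue module, in coordinates -/

section TorCriterion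

variable {k : Type w} [CommRing k] {A : Type u} [CommRing A] [Algebra k A]

/-- P ⊗ A/J is P/JP, and a basis identifies JP with the vectors whose coordinates lie in J. -/
theorem tmul_one_eq_zero_iff {P : Type u} [AddCommGroup P] [Module A P] {ι : Type v}
    (b : Module.Basis ι A P) (J : Ideal A) (x : P) :
    x ⊗ₜ[A] (1 : A ⧸ J) = 0 ↔ b.repr x ∈ coordIdeal J ι := by
  have h1 : (TensorProduct.tensorQuotEquivQuotSMul P J) (x ⊗ₜ[A] (1 : A ⧸ J)) =
      Submodule.Quotient.mk x := by
    have := TensorProduct.tensorQuotEquivQuotSMul_tmul_mk J x 1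
    rwa [one_smul, map_one] at this
  rw [← (TensorProduct.tensorQuotEquivQuotSMul P J).map_eq_zero_iff, h1,
    Submodule.Quotient.mk_eq_zero, coordIdeal_eq_smul_top]
  have h2 : (J • (⊤ : Submodule A P)).map b.repr.toLinearMap = J • ⊤ := by
    rw [Submodule.map_smul'', Submodule.map_top, LinearEquiv.range]
  rw [← h2]
  constructor
  · exact fun hx => ⟨x, hx, rfl⟩
  · rintro ⟨y, hy, hyx⟩
    rwa [← b.repr.injective hyx]

theorem exists_eq_tmul_one {P : Type u} [AddCommGroup P] [Module A P] (J : Ideal A)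
    (z : P ⊗[A] (A ⧸ J)) : ∃ x : P, x ⊗ₜ[A] (1 : A ⧸ J) = z := by
  induction z using TensorProduct.induction_on with
  | zero => exact ⟨0, TensorProduct.zero_tmul _ _⟩
  | tmul x y =>
    obtain ⟨a, rfl⟩ := Ideal.Quotient.mk_surjective y
    refine ⟨a • x, ?_⟩
    rw [TensorProduct.smul_tmul]
    congr 1
    rw [Algebra.smul_def, mul_one]
    rfl
  | add x y hx hy =>
    obtain ⟨x, rfl⟩ := hx
    obtain ⟨y, rfl⟩ := hy
    exact ⟨x + y, TensorProduct.add_tmul _ _ _⟩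

variable {𝒜 : ℕ → Submodule k A} [GradedAlgebra 𝒜]

/-- A homogeneous class of the residue module lifts to a homogeneous `a`, which can be moved to the
left factor. -/
theorem mem_tensorGrading_iff {P : Type u} [AddCommGroup P] [Module k P] [Module A P]
    [IsScalarTower k A P] {ι : Type v} (b : Module.Basis ι A P) (deg : ι → ℕ) (d : ℕ)
    (z : P ⊗[A] ResidueModule 𝒜) :
    z ∈ tensorGrading A (basisGrading 𝒜 b deg) (residueGrading 𝒜) d ↔
      ∃ x ∈ basisGrading 𝒜 b deg d, x ⊗ₜ[A] (1 : ResidueModule 𝒜) = z := by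
  constructor
  · intro hz
    induction hz using Submodule.span_induction with
    | mem z hz =>
      obtain ⟨i, j, rfl, x, hx, _, ⟨a, ha, rfl⟩, rfl⟩ := hz
      refine ⟨a • x, ?_, ?_⟩
      · change b.repr (a • x) ∈ freeGrading 𝒜 deg (i + j)
        rw [map_smul, add_comm]
        exact SetLike.GradedSMul.smul_mem (B := freeGrading 𝒜 deg) ha hx
      · rw [TensorProduct.smul_tmul]
        congr 1
        rw [Algebra.smul_def, mul_one]
        rfl
    | zero => exact ⟨0, zero_mem _, TensorProduct.zero_tmul _ _⟩
    | add x y _ _ hx hy =>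
      obtain ⟨x, hx, rfl⟩ := hx
      obtain ⟨y, hy, rfl⟩ := hy
      exact ⟨x + y, add_mem hx hy, TensorProduct.add_tmul _ _ _⟩
    | smul r x _ hx =>
      obtain ⟨x, hx, rfl⟩ := hx
      exact ⟨r • x, Submodule.smul_mem _ r hx, TensorProduct.smul_tmul' _ _ _⟩
  · rintro ⟨x, hx, rfl⟩
    exact Submodule.subset_span ⟨d, 0, add_zero d, x, hx, 1,
      ⟨1, SetLike.GradedOne.one_mem, rfl⟩, rfl⟩

/-! ### Differentials and Tor vanishing in coordinates. -/

namespace GradedFreeResolution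

variable {M : Type u} [AddCommGroup M] [Module k M] [Module A M]
variable {ℳ : ℕ → Submodule k M} (F : GradedFreeResolution 𝒜 ℳ)

/-- The differential in coordinates. -/
def coordD (i : ℕ) : (F.ι (i + 1) →₀ A) →ₗ[A] (F.ι i →₀ A) :=
  (F.basis i).repr.toLinearMap ∘ₗ F.d i ∘ₗ (F.basis (i + 1)).repr.symm.toLinearMap

/-- The augmentation in coordinates. -/
def coordAug : (F.ι 0 →₀ A) →ₗ[A] M :=
  F.aug ∘ₗ (F.basis 0).repr.symm.toLinearMap

omit [GradedAlgebra 𝒜] in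
theorem coordD_repr (i : ℕ) (x : F.F (i + 1)) :
    F.coordD i ((F.basis (i + 1)).repr x) = (F.basis i).repr (F.d i x) := by
  simp [coordD]

omit [GradedAlgebra 𝒜] in
theorem coordD_mem (i d : ℕ) (x) (hx : x ∈ freeGrading 𝒜 (F.deg (i + 1)) d) :
    F.coordD i x ∈ freeGrading 𝒜 (F.deg i) d := by
  refine F.d_mem i d _ ?_
  change (F.basis (i + 1)).repr ((F.basis (i + 1)).repr.symm x) ∈
    freeGrading 𝒜 (F.deg (i + 1)) d
  rwa [LinearEquiv.apply_symm_apply]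

omit [GradedAlgebra 𝒜] in
theorem coordAug_mem (d : ℕ) (x) (hx : x ∈ freeGrading 𝒜 (F.deg 0) d) : F.coordAug x ∈ ℳ d := by
  refine F.aug_mem d _ ?_
  change (F.basis 0).repr ((F.basis 0).repr.symm x) ∈ freeGrading 𝒜 (F.deg 0) d
  rwa [LinearEquiv.apply_symm_apply]

omit [GradedAlgebra 𝒜] in
theorem ker_coordD (i : ℕ) :
    LinearMap.ker (F.coordD i) = LinearMap.range (F.coordD (i + 1)) := by
  ext x
  constructor
  · intro hx
    have : F.d i ((F.basis (i + 1)).repr.symm x) = 0 := by simpa [coordD] using hx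
    obtain ⟨y, hy⟩ := (F.exact_d i _).mp this
    exact ⟨(F.basis (i + 2)).repr y, by rw [coordD_repr, hy, LinearEquiv.apply_symm_apply]⟩
  · rintro ⟨y, rfl⟩
    obtain ⟨y, rfl⟩ := (F.basis (i + 2)).repr.surjective y
    rw [LinearMap.mem_ker, coordD_repr, coordD_repr, (F.exact_d i _).mpr ⟨_, rfl⟩, map_zero]

omit [GradedAlgebra 𝒜] in
theorem ker_coordAug : LinearMap.ker F.coordAug = LinearMap.range (F.coordD 0) := by
  ext x
  constructor
  · intro hx
    obtain ⟨y, hy⟩ := (F.exact_aug _).mp (LinearMap.mem_ker.mp hx)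
    exact ⟨(F.basis 1).repr y, by
      rw [coordD_repr, hy]
      simp⟩
  · rintro ⟨y, rfl⟩
    obtain ⟨y, rfl⟩ := (F.basis 1).repr.surjective y
    rw [LinearMap.mem_ker, coordD_repr, coordAug, LinearMap.comp_apply, LinearEquiv.coe_coe,
      LinearEquiv.symm_apply_apply]
    exact (F.exact_aug _).mpr ⟨_, rfl⟩

omit [GradedAlgebra 𝒜] in
theorem coordAug_surjective : Function.Surjective F.coordAug :=
  F.aug_surjective.comp (F.basis 0).repr.symm.surjective

theorem subsingleton_homology_iff (i d : ℕ) :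
    Subsingleton (F.Homology (residueGrading 𝒜) i d) ↔
      F.gradedCycles (residueGrading 𝒜) i d ≤ F.gradedBoundaries (residueGrading 𝒜) i d := by
  rw [Submodule.Quotient.subsingleton_iff, Submodule.submoduleOf_eq_top]

theorem tmul_mem_boundaries_iff (i : ℕ) (x : F.F i) :
    x ⊗ₜ[A] (1 : ResidueModule 𝒜) ∈ F.boundaries (ResidueModule 𝒜) i ↔
      ∃ y, (F.basis i).repr x - F.coordD i y ∈
        coordIdeal (HomogeneousIdeal.irrelevant 𝒜).toIdeal (F.ι i) := by
  constructor
  · rintro ⟨z, hz⟩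
    obtain ⟨y, rfl⟩ := exists_eq_tmul_one _ z
    refine ⟨(F.basis (i + 1)).repr y, ?_⟩
    rw [coordD_repr, ← map_sub, ← tmul_one_eq_zero_iff, TensorProduct.sub_tmul, ← hz]
    exact sub_self _
  · rintro ⟨y, hy⟩
    obtain ⟨y, rfl⟩ := (F.basis (i + 1)).repr.surjective y
    rw [coordD_repr, ← map_sub, ← tmul_one_eq_zero_iff, TensorProduct.sub_tmul] at hy
    exact ⟨y ⊗ₜ 1, (sub_eq_zero.mp hy).symm⟩

/-- The vanishing of `Tor_{i+1}` with the residue module in degree `d`, in coordinates. -/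
theorem subsingleton_homology_succ_iff (i d : ℕ) :
    Subsingleton (F.Homology (residueGrading 𝒜) (i + 1) d) ↔
      ∀ x ∈ freeGrading 𝒜 (F.deg (i + 1)) d,
        F.coordD i x ∈ coordIdeal (HomogeneousIdeal.irrelevant 𝒜).toIdeal (F.ι i) →
        ∃ y, x - F.coordD (i + 1) y ∈
          coordIdeal (HomogeneousIdeal.irrelevant 𝒜).toIdeal (F.ι (i + 1)) := by
  rw [subsingleton_homology_iff]
  constructor
  · intro h x hx hdx
    obtain ⟨x, rfl⟩ := (F.basis (i + 1)).repr.surjective x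
    rw [coordD_repr, ← tmul_one_eq_zero_iff] at hdx
    rw [← tmul_mem_boundaries_iff]
    exact (h ⟨hdx, (mem_tensorGrading_iff _ _ _ _).mpr ⟨x, hx, rfl⟩⟩).1
  · rintro h z ⟨hz, hzd⟩
    refine ⟨?_, hzd⟩
    obtain ⟨x, hx, rfl⟩ := (mem_tensorGrading_iff _ _ _ _).mp hzd
    refine (F.tmul_mem_boundaries_iff _ x).mpr (h _ hx ?_)
    rw [coordD_repr, ← tmul_one_eq_zero_iff]
    exact hz

theorem subsingleton_homology_zero_iff (d : ℕ) :
    Subsingleton (F.Homology (residueGrading 𝒜) 0 d) ↔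
      ∀ x ∈ freeGrading 𝒜 (F.deg 0) d, ∃ y, x - F.coordD 0 y ∈
          coordIdeal (HomogeneousIdeal.irrelevant 𝒜).toIdeal (F.ι 0) := by
  rw [subsingleton_homology_iff]
  constructor
  · intro h x hx
    obtain ⟨x, rfl⟩ := (F.basis 0).repr.surjective x
    rw [← tmul_mem_boundaries_iff]
    exact (h ⟨trivial, (mem_tensorGrading_iff _ _ _ _).mpr ⟨x, hx, rfl⟩⟩).1
  · rintro h z ⟨-, hzd⟩
    refine ⟨?_, hzd⟩
    obtain ⟨x, hx, rfl⟩ := (mem_tensorGrading_iff _ _ _ _).mp hzd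
    exact (F.tmul_mem_boundaries_iff _ x).mpr (h _ hx)

end GradedFreeResolution

end TorCriterion

/-! ### Submodules of graded free modules over the polynomial ring -/

section FreePolynomial

open MvPolynomial

variable {n : ℕ} {k : Type u} [Field k]

theorem coeff_zero_of_mem_freeGrading {ι : Type*} {deg : ι → ℕ} {d : ℕ}
    {x : ι →₀ MvPolynomial (Fin n) k}
    (hx : x ∈ freeGrading (homogeneousSubmodule (Fin n) k) deg d) {c : ι} (hc : deg c ≠ d) :
    coeff 0 (x c) = 0 := by
  have := hx c
  unfold twist at this
  split_ifs at this with h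
  · refine IsHomogeneous.coeff_eq_zero this ?_
    rw [map_zero]
    omega
  · rw [(Submodule.mem_bot k).mp this, coeff_zero]

theorem eq_C_coeff_zero_of_mem_freeGrading {ι : Type*} {deg : ι → ℕ} {d : ℕ}
    {x : ι →₀ MvPolynomial (Fin n) k}
    (hx : x ∈ freeGrading (homogeneousSubmodule (Fin n) k) deg d) {c : ι} (hc : deg c = d) :
    x c = C (coeff 0 (x c)) := by
  have := hx c
  unfold twist at this
  rw [if_pos hc.le, hc, Nat.sub_self] at this
  rw [← homogeneousComponent_zero, homogeneousComponent_of_mem this, if_pos rfl]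

/-- A homogeneous Koszul primitive at the end of the complex writes `x` as a combination of the
variables with coefficients of degree `a`. -/
theorem mem_mulSpan_top {ι : Type u} {deg : ι → ℕ} {a : ℕ} {x : ι →₀ MvPolynomial (Fin n) k}
    (hx : x ∈ coordIdeal (HomogeneousIdeal.irrelevant
      (homogeneousSubmodule (Fin n) k)).toIdeal ι)
    (hxa : x ∈ freeGrading (homogeneousSubmodule (Fin n) k) deg (a + 1)) :
    x ∈ mulSpan (freeGrading (homogeneousSubmodule (Fin n) k) deg)
      (⊤ : Submodule (MvPolynomial (Fin n) k) (ι →₀ MvPolynomial (Fin n) k)) 1 a := by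
  obtain ⟨g, hg⟩ := koszul_exact_free_zero (fun _ => x) fun _ => hx
  obtain ⟨g, -, hga, hg⟩ := exists_homogeneous_primitive_eq
    (isHomogeneous_top (A := MvPolynomial (Fin n) k) _) (fun _ => hxa) (fun _ => trivial) hg
  obtain ⟨s⟩ := koszulIndex_zero_nonempty n
  rw [← congrFun hg s]
  exact koszulD_mem_mulSpan (fun _ => Submodule.mem_top) hga s

theorem component_mem_coordIdeal {ι : Type u} (deg : ι → ℕ) (a : ℕ)
    {x : ι →₀ MvPolynomial (Fin n) k}
    (hx : x ∈ coordIdeal (HomogeneousIdeal.irrelevant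
      (homogeneousSubmodule (Fin n) k)).toIdeal ι) :
    component (freeGrading (homogeneousSubmodule (Fin n) k) deg) (a + 1) x ∈
      coordIdeal (HomogeneousIdeal.irrelevant (homogeneousSubmodule (Fin n) k)).toIdeal ι := by
  obtain ⟨g, hg⟩ := koszul_exact_free_zero (fun _ => x) fun _ => hx
  obtain ⟨s⟩ := koszulIndex_zero_nonempty n
  have h := koszulD_map (varSeq n k)
    (component (freeGrading (homogeneousSubmodule (Fin n) k) deg) (1 + a)) _
    (fun i m => component_smul _ (homogeneousSubmodule (Fin n) k) (varSeq_mem i) a m) n 0 g s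
  rw [← congrFun hg s, add_comm, h, coordIdeal_eq_smul_top]
  exact koszulD_mem_irrelevant_smul ⊤ (fun _ => trivial) s

/-- If the first Koszul homology of the range of `D` vanishes, then the elements of the kernel
of `D` with coordinates of positive degree are not minimal generators of the kernel. -/
theorem KoszulVanishes.mem_mulSpan_ker {ι ι' : Type u} {deg : ι → ℕ} {deg' : ι' → ℕ}
    (D : (ι →₀ MvPolynomial (Fin n) k) →ₗ[MvPolynomial (Fin n) k]
      (ι' →₀ MvPolynomial (Fin n) k))
    (hD : ∀ d, ∀ x ∈ freeGrading (homogeneousSubmodule (Fin n) k) deg d,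
      D x ∈ freeGrading (homogeneousSubmodule (Fin n) k) deg' d) {a : ℕ}
    (h : KoszulVanishes (freeGrading (homogeneousSubmodule (Fin n) k) deg')
      (LinearMap.range D) ⊥ 0 a) {z : ι →₀ MvPolynomial (Fin n) k} (hz : z ∈ LinearMap.ker D)
    (hz0 : z ∈ coordIdeal (HomogeneousIdeal.irrelevant
      (homogeneousSubmodule (Fin n) k)).toIdeal ι)
    (hza : z ∈ freeGrading (homogeneousSubmodule (Fin n) k) deg (a + 2)) :
    z ∈ mulSpan (freeGrading (homogeneousSubmodule (Fin n) k) deg) (LinearMap.ker D) 1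
      (a + 1) := by
  obtain ⟨g, hg⟩ := koszul_exact_free_zero (fun _ => z) fun _ => hz0
  obtain ⟨s⟩ := koszulIndex_zero_nonempty n
  -- `z` is a combination of the variables with coefficients in the free module; the vanishing for
  -- the range of `D` moves these coefficients into the kernel.
  obtain ⟨g, hgD, hg⟩ := exists_primitive_mem_ker D hD (fun _ => hz) (fun _ => hza) hg h
  obtain ⟨g, hgD, hga, hg⟩ := exists_homogeneous_primitive_eq
    (isHomogeneous_ker _ _ D hD) (fun _ => hza) hgD hg
  rw [← congrFun hg s]
  exact koszulD_mem_mulSpan hgD hga s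

/-! ### Elements of Z with coordinates in I, compared with IZ. -/

section IdealSmul

variable {ι : Type u} {deg : ι → ℕ} {Z : Submodule (MvPolynomial (Fin n) k)
  (ι →₀ MvPolynomial (Fin n) k)} {I : Ideal (MvPolynomial (Fin n) k)}

/-- Modulo IZ, the forms that multiply elements of `Z` can be taken from a basis of a complement of
I in degree `m`. In a coordinate of degree `a + 1` the multiplied elements have constant entries, so
membership of `u` in I gives a linear relation modulo I and the constants vanish. The multiplied
elements then have coordinates of positive degree, and `hP` splits a linear form off each of them.
-/
theorem mem_sup_mulSpan_succ {m a : ℕ}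
    (hP : ∀ z ∈ Z, z ∈ coordIdeal (HomogeneousIdeal.irrelevant
        (homogeneousSubmodule (Fin n) k)).toIdeal ι →
      z ∈ freeGrading (homogeneousSubmodule (Fin n) k) deg (a + 1) →
      z ∈ mulSpan (freeGrading (homogeneousSubmodule (Fin n) k) deg) Z 1 a)
    {u : ι →₀ MvPolynomial (Fin n) k}
    (hu : u ∈ mulSpan (freeGrading (homogeneousSubmodule (Fin n) k) deg) Z m (a + 1))
    (huI : u ∈ coordIdeal I ι) :
    u ∈ (I • Z).toAddSubgroup ⊔
      mulSpan (freeGrading (homogeneousSubmodule (Fin n) k) deg) Z (m + 1) a := by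
  classical
  obtain ⟨Q', hQ'⟩ := Submodule.exists_isCompl
    (I.restrictScalars k ⊓ homogeneousSubmodule (Fin n) k m)
  -- A complement of the degree `m` part of I in the forms of degree `m`.
  let Q : Submodule k (MvPolynomial (Fin n) k) := Q' ⊓ homogeneousSubmodule (Fin n) k m
  let v := Module.Basis.ofVectorSpace k Q
  let Φ : (Module.Basis.ofVectorSpaceIndex k Q →₀ (ι →₀ MvPolynomial (Fin n) k)) →+
      (ι →₀ MvPolynomial (Fin n) k) :=
    Finsupp.liftAddHom fun j => DistribSMul.toAddMonoidHom _ (v j : MvPolynomial (Fin n) k)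
  have hΦ : ∀ w, Φ w = w.sum fun j y => (v j : MvPolynomial (Fin n) k) • y := fun w => rfl
  -- modulo `I • Z` the coefficients can be taken in the chosen complement of `I`
  obtain ⟨w, hw, hwI⟩ : ∃ w : Module.Basis.ofVectorSpaceIndex k Q →₀
      (ι →₀ MvPolynomial (Fin n) k), (∀ j, w j ∈ Z ∧
        w j ∈ freeGrading (homogeneousSubmodule (Fin n) k) deg (a + 1)) ∧ u - Φ w ∈ I • Z := by
    clear huI
    induction hu using AddSubgroup.closure_induction with
    | mem y hy =>
      obtain ⟨b, hb, z, hz, hza, rfl⟩ := hy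
      obtain ⟨i, q, hi, hq, rfl⟩ := Submodule.codisjoint_iff_exists_add_eq.mp hQ'.codisjoint b
      have hqm : q ∈ homogeneousSubmodule (Fin n) k m := by
        have := sub_mem hb hi.2
        rwa [add_sub_cancel_left] at this
      refine ⟨(v.repr ⟨q, hq, hqm⟩).mapRange (fun r => r • z) (zero_smul k z), fun j => ?_, ?_⟩
      · rw [Finsupp.mapRange_apply]
        refine ⟨?_, Submodule.smul_mem _ _ hza⟩
        exact (Z.restrictScalars k).smul_mem _ hz
      · have : Φ ((v.repr ⟨q, hq, hqm⟩).mapRange (fun r => r • z) (zero_smul k z)) = q • z := by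
          rw [hΦ, Finsupp.sum_mapRange_index (by simp)]
          have hs := congrArg (Subtype.val : Q → MvPolynomial (Fin n) k)
            (v.linearCombination_repr ⟨q, hq, hqm⟩)
          rw [Finsupp.linearCombination_apply, Finsupp.sum, Submodule.coe_sum] at hs
          refine Eq.trans ?_ (congrArg (· • z) hs)
          rw [Finsupp.sum, Finset.sum_smul]
          refine Finset.sum_congr rfl fun j _ => ?_
          rw [Submodule.coe_smul, smul_assoc, smul_comm]
        rw [this, add_smul, add_sub_cancel_right]
        exact Submodule.smul_mem_smul hi.1 hz
    | zero => exact ⟨0, fun j => ⟨zero_mem _, zero_mem _⟩, by simp⟩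
    | add x y _ _ hx hy =>
      obtain ⟨w, hw, hx⟩ := hx
      obtain ⟨w', hw', hy⟩ := hy
      refine ⟨w + w', fun j => ⟨add_mem (hw j).1 (hw' j).1, add_mem (hw j).2 (hw' j).2⟩, ?_⟩
      rw [map_add, add_sub_add_comm]
      exact add_mem hx hy
    | neg x _ hx =>
      obtain ⟨w, hw, hx⟩ := hx
      refine ⟨-w, fun j => ⟨neg_mem (hw j).1, neg_mem (hw j).2⟩, ?_⟩
      rw [show Φ (-w) = -Φ w from map_neg Φ w, ← neg_sub']
      exact neg_mem hx
  have hΦI : Φ w ∈ coordIdeal I ι := by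
    have h1 : u - Φ w ∈ coordIdeal I ι := by
      rw [coordIdeal_eq_smul_top]
      exact Submodule.smul_mono le_rfl le_top hwI
    have := sub_mem huI h1
    rwa [sub_sub_cancel] at this
  have hw0 : ∀ j, w j ∈ coordIdeal (HomogeneousIdeal.irrelevant
      (homogeneousSubmodule (Fin n) k)).toIdeal ι := by
    intro j c
    rw [mem_irrelevant_iff_coeff]
    by_cases hc : deg c = a + 1
    -- `L` collects the constants in coordinate `c`; the corresponding element of `Q` is the
    -- coordinate of `Φ w`, which lies in I and hence is zero.
    · let L : Module.Basis.ofVectorSpaceIndex k Q →₀ k :=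
        w.mapRange (fun y => coeff 0 (y c)) (coeff_zero 0)
      have hL : ((v.repr.symm L : Q) : MvPolynomial (Fin n) k) = Φ w c := by
        simp only [L]
        rw [Module.Basis.repr_symm_apply, Finsupp.linearCombination_apply,
          Finsupp.sum_mapRange_index (fun j => zero_smul k (v j)), hΦ, Finsupp.sum, Finsupp.sum,
          Submodule.coe_sum,
          Finsupp.finsetSum_apply]
        refine Finset.sum_congr rfl fun j _ => ?_
        rw [Finsupp.smul_apply, eq_C_coeff_zero_of_mem_freeGrading (hw j).2 hc, coeff_C,
          if_pos rfl, smul_eq_mul, mul_comm, ← smul_eq_C_mul]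
        rfl
      have hL0 : v.repr.symm L = 0 := by
        apply Subtype.ext
        have h1 : ((v.repr.symm L : Q) : MvPolynomial (Fin n) k) ∈
            I.restrictScalars k ⊓ homogeneousSubmodule (Fin n) k m :=
          ⟨by rw [hL]; exact hΦI c, (v.repr.symm L).2.2⟩
        exact Submodule.disjoint_def.mp hQ'.disjoint _ h1 (v.repr.symm L).2.1
      exact DFunLike.congr_fun (v.repr.symm.map_eq_zero_iff.mp hL0) j
    · exact coeff_zero_of_mem_freeGrading (hw j).2 hc
  have hΦm : Φ w ∈ mulSpan (freeGrading (homogeneousSubmodule (Fin n) k) deg) Z (m + 1) a :=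
    sum_mem fun j _ => smul_mem_mulSpan (v j).2.2 (hP _ (hw j).1 (hw0 j) (hw j).2)
  rw [← sub_add_cancel u (Φ w)]
  exact add_mem (AddSubgroup.mem_sup_left hwI) (AddSubgroup.mem_sup_right hΦm)

/-- If, in degrees above `τ`, the elements of `Z` with coordinates of positive degree are not
minimal generators of `Z`, and `I` contains all forms of degree above `e`, then, in degrees above
`τ + e`, the elements of `Z` with coordinates in `I` lie in `I Z`. -/
theorem mem_ideal_smul_of_mem_coordIdeal {τ e : ℕ}
    (hP : ∀ a, τ ≤ a → ∀ z ∈ Z, z ∈ coordIdeal (HomogeneousIdeal.irrelevant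
        (homogeneousSubmodule (Fin n) k)).toIdeal ι →
      z ∈ freeGrading (homogeneousSubmodule (Fin n) k) deg (a + 1) →
      z ∈ mulSpan (freeGrading (homogeneousSubmodule (Fin n) k) deg) Z 1 a)
    (hI : ∀ m, e < m → ∀ b ∈ homogeneousSubmodule (Fin n) k m, b ∈ I) {d : ℕ} (hd : τ + e < d)
    {z : ι →₀ MvPolynomial (Fin n) k} (hz : z ∈ Z) (hzI : z ∈ coordIdeal I ι)
    (hzd : z ∈ freeGrading (homogeneousSubmodule (Fin n) k) deg d) : z ∈ I • Z := by
  -- Degree is moved from the elements of `Z` to the forms, one unit at a time. The element degree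
  -- never falls below `τ`, and for `m = e + 1` the forms lie in I.
  have key : ∀ m, m ≤ e + 1 → z ∈ (I • Z).toAddSubgroup ⊔
      mulSpan (freeGrading (homogeneousSubmodule (Fin n) k) deg) Z m (d - m) := by
    intro m
    induction m with
    | zero =>
      exact fun _ => AddSubgroup.mem_sup_right (AddSubgroup.subset_closure
        ⟨1, isHomogeneous_one _ _, z, hz, hzd, one_smul _ z⟩)
    | succ m ih =>
      intro hm
      obtain ⟨y, hy, u, hu, hyu⟩ := AddSubgroup.mem_sup.mp (ih (by omega))
      have huI : u ∈ coordIdeal I ι := by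
        have h1 : y ∈ coordIdeal I ι := by
          rw [coordIdeal_eq_smul_top]
          exact Submodule.smul_mono le_rfl le_top hy
        have := sub_mem hzI h1
        rwa [← hyu, add_sub_cancel_left] at this
      rw [← hyu]
      refine add_mem (AddSubgroup.mem_sup_left hy) ?_
      rw [show d - m = d - (m + 1) + 1 by omega] at hu
      exact mem_sup_mulSpan_succ (hP _ (by omega)) hu huI
  have := key (e + 1) le_rfl
  rwa [sup_eq_left.mpr (mulSpan_le_smul (hI (e + 1) (by omega)) _)] at this

end IdealSmul

/-! ### From Tor₁(I, k) to the second Koszul homology of B/I. -/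

theorem koszul_exact_self (j : ℕ) (f : KoszulIndex n (j + 1) → MvPolynomial (Fin n) k)
    (hf : koszulD (varSeq n k) n j f = 0) : ∃ g, koszulD (varSeq n k) n (j + 1) g = f := by
  let φ : MvPolynomial (Fin n) k →ₗ[MvPolynomial (Fin n) k] (Unit →₀ MvPolynomial (Fin n) k) :=
    Finsupp.lsingle ()
  let ψ : (Unit →₀ MvPolynomial (Fin n) k) →ₗ[MvPolynomial (Fin n) k] MvPolynomial (Fin n) k :=
    Finsupp.lapply ()
  obtain ⟨g, hg⟩ := koszul_exact_free j (φ ∘ f) (funext fun s => by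
    rw [← koszulD_linearMap, hf]
    exact map_zero φ)
  refine ⟨ψ ∘ g, funext fun s => ?_⟩
  rw [← koszulD_linearMap, hg]
  simp [φ, ψ]

/-- If `Tor_1(I, k)` vanishes in degree `e + 2` and `I` contains all forms of degree `e + 1`, then
the second Koszul homology of `B ⧸ I` vanishes with coefficients in degree `e`. -/
theorem exists_koszul_primitive_of_subsingleton
    (I : HomogeneousIdeal (homogeneousSubmodule (Fin n) k))
    (F : GradedFreeResolution (homogeneousSubmodule (Fin n) k) I.grading) {e : ℕ}
    (hF : Subsingleton (F.Homology (residueGrading (homogeneousSubmodule (Fin n) k)) 1 (e + 2)))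
    (hI : ∀ b ∈ homogeneousSubmodule (Fin n) k (e + 1), b ∈ I.toIdeal)
    (f : KoszulIndex n 2 → MvPolynomial (Fin n) k)
    (hf : ∀ s, f s ∈ homogeneousSubmodule (Fin n) k e) :
    ∃ g : KoszulIndex n 3 → MvPolynomial (Fin n) k,
      ∀ s, f s - koszulD (varSeq n k) n 2 g s ∈ I.toIdeal := by
  rw [F.subsingleton_homology_succ_iff] at hF
  -- A zigzag between the Koszul complex and F₁ → F₀ → I ⊆ B. The boundary of `f` has degree `e +
  -- 1`, so it lies in I automatically and lifts to `g` in F₀. The boundary of `g` maps to zero in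
  -- I, so it comes from `w` in F₁.
  have hdf (s) : koszulD (varSeq n k) n 1 f s ∈ homogeneousSubmodule (Fin n) k (e + 1) :=
    koszulD_mem_grading hf s
  choose g hgd hg using fun s => exists_mem_of_mem_range _ I.grading F.coordAug F.coordAug_mem
    (F.coordAug_surjective ⟨_, hI _ (hdf s)⟩) (show _ ∈ I.grading (e + 1) from hdf s)
  have hg' : (I.toIdeal.subtype ∘ₗ F.coordAug) ∘ g = koszulD (varSeq n k) n 1 f := by
    funext s
    exact congrArg Subtype.val (hg s)
  have hdg (s) : koszulD (varSeq n k) n 0 g s ∈ freeGrading _ (F.deg 0) (e + 2) :=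
    koszulD_mem_grading hgd s
  choose w hwd hw using fun s => exists_mem_of_mem_range _ _ (F.coordD 0) (F.coordD_mem 0)
    (show koszulD (varSeq n k) n 0 g s ∈ LinearMap.range (F.coordD 0) by
      rw [← F.ker_coordAug, LinearMap.mem_ker]
      apply Subtype.ext
      have := koszulD_linearMap (varSeq n k) (I.toIdeal.subtype ∘ₗ F.coordAug) n 0 g s
      rw [hg', koszulD_koszulD] at this
      exact this) (hdg s)
  -- `w` is a cycle for Tor₁(I, k) in degree `e + 2`; by vanishing it is a boundary up to
  -- coordinates of positive degree, and those bound a chain `v`.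
  choose y hy using fun s => hF (w s) (hwd s) (by
    rw [hw, coordIdeal_eq_smul_top]
    exact koszulD_mem_irrelevant_smul ⊤ (fun _ => trivial) s)
  obtain ⟨v, hv⟩ := koszul_exact_free_zero _ hy
  -- Going back up: each corrected chain is a Koszul cycle, hence a boundary. Finally `f` differs
  -- from a boundary by the values of the augmentation, which lie in I.
  obtain ⟨h, hh⟩ := koszul_exact_free 0 (g - F.coordD 0 ∘ v) (by
    funext s
    have hDD : F.coordD 0 (F.coordD 1 (y s)) = 0 := by
      rw [← LinearMap.mem_ker, F.ker_coordD]
      exact ⟨_, rfl⟩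
    rw [koszulD_sub, Pi.sub_apply, ← koszulD_linearMap, hv, map_sub, hw, hDD, sub_zero, sub_self]
    rfl)
  obtain ⟨q, hq⟩ := koszul_exact_self 1 (f - (I.toIdeal.subtype ∘ₗ F.coordAug) ∘ h) (by
    funext s
    have hv0 : F.coordAug (F.coordD 0 (v s)) = 0 := by
      rw [← LinearMap.mem_ker, F.ker_coordAug]
      exact ⟨_, rfl⟩
    rw [koszulD_sub, Pi.sub_apply, ← koszulD_linearMap, hh, Pi.sub_apply, map_sub, ← hg']
    simp [hv0])
  refine ⟨q, fun s => ?_⟩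
  rw [hq, Pi.sub_apply, sub_sub_cancel]
  exact (F.coordAug (h s)).2

end FreePolynomial

/-! ### Base change of free modules -/

section FreeBaseChange

variable {R : Type*} (A : Type*) [CommRing R] [CommRing A] [Algebra R A]
variable {ι ι' ι'' : Type*}

/-- The map from the free module over `R` to the free module over the `R`-algebra `A`. -/
def freeInclusion (ι : Type*) : (ι →₀ R) →ₗ[R] (ι →₀ A) :=
  Finsupp.mapRange.linearMap (Algebra.linearMap R A)

@[simp]
theorem freeInclusion_apply (x : ι →₀ R) (c : ι) :
    freeInclusion A ι x c = algebraMap R A (x c) := rfl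

theorem freeInclusion_single (c : ι) (a : R) :
    freeInclusion A ι (Finsupp.single c a) = Finsupp.single c (algebraMap R A a) :=
  Finsupp.mapRange_single (hf := map_zero _)

/-- The extension of scalars of a map of free modules. -/
def freeBaseChange (φ : (ι →₀ R) →ₗ[R] (ι' →₀ R)) : (ι →₀ A) →ₗ[A] (ι' →₀ A) :=
  Finsupp.linearCombination A fun c => freeInclusion A ι' (φ (Finsupp.single c 1))

variable (φ : (ι →₀ R) →ₗ[R] (ι' →₀ R))

theorem freeBaseChange_freeInclusion (x : ι →₀ R) :
    freeBaseChange A φ (freeInclusion A ι x) = freeInclusion A ι' (φ x) := by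
  induction x using Finsupp.induction_linear with
  | zero => simp
  | add x y hx hy => simp only [map_add, hx, hy]
  | single c a =>
    have h2 : Finsupp.single c a = a • Finsupp.single c (1 : R) := by simp
    rw [freeInclusion_single, h2, map_smul, map_smul, freeBaseChange,
      Finsupp.linearCombination_single, algebraMap_smul]

variable (R) in
theorem single_eq_smul_freeInclusion (c : ι) (a : A) :
    Finsupp.single c a = a • freeInclusion A ι (Finsupp.single c (1 : R)) := by
  rw [freeInclusion_single]
  simp

variable (R) {A} in
theorem free_linearMap_ext {f g : (ι →₀ A) →ₗ[A] (ι' →₀ A)}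
    (h : ∀ c : ι, f (freeInclusion A ι (Finsupp.single c (1 : R))) =
      g (freeInclusion A ι (Finsupp.single c (1 : R)))) : f = g :=
  Finsupp.lhom_ext fun c a => by
    rw [single_eq_smul_freeInclusion R, map_smul, map_smul, h]

theorem freeBaseChange_comp (ψ : (ι' →₀ R) →ₗ[R] (ι'' →₀ R)) :
    freeBaseChange A (ψ ∘ₗ φ) = freeBaseChange A ψ ∘ₗ freeBaseChange A φ :=
  free_linearMap_ext R fun c => by simp [freeBaseChange_freeInclusion]

theorem freeBaseChange_add (ψ : (ι →₀ R) →ₗ[R] (ι' →₀ R)) :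
    freeBaseChange A (φ + ψ) = freeBaseChange A φ + freeBaseChange A ψ :=
  free_linearMap_ext R fun c => by simp [freeBaseChange_freeInclusion]

theorem freeBaseChange_zero : freeBaseChange A (0 : (ι →₀ R) →ₗ[R] (ι' →₀ R)) = 0 :=
  free_linearMap_ext R fun c => by simp [freeBaseChange_freeInclusion]

theorem freeBaseChange_smul_id (a : R) :
    freeBaseChange A (a • LinearMap.id : (ι →₀ R) →ₗ[R] (ι →₀ R)) =
      algebraMap R A a • LinearMap.id :=
  free_linearMap_ext R fun c => by
    rw [freeBaseChange_freeInclusion, LinearMap.smul_apply, LinearMap.smul_apply,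
      LinearMap.id_apply, LinearMap.id_apply, map_smul, algebraMap_smul]

variable {A}

theorem map_smul_freeInclusion (π : A →ₗ[R] R) (a : A) (y : ι →₀ R) :
    Finsupp.mapRange.linearMap π (a • freeInclusion A ι y) = π a • y := by
  ext1 c
  change π (a * algebraMap R A (y c)) = π a * y c
  rw [mul_comm, mul_comm (π a), ← smul_eq_mul (y c), ← map_smul, Algebra.smul_def]

/-- A splitting commutes with extended maps. -/
theorem map_freeBaseChange (π : A →ₗ[R] R) (x : ι →₀ A) :
    Finsupp.mapRange.linearMap π (freeBaseChange A φ x) =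
      φ (Finsupp.mapRange.linearMap π x) := by
  induction x using Finsupp.induction_linear with
  | zero => simp
  | add x y hx hy => simp only [map_add, hx, hy]
  | single c a =>
    rw [single_eq_smul_freeInclusion R, map_smul, freeBaseChange_freeInclusion,
      map_smul_freeInclusion, map_smul_freeInclusion, map_smul]

end FreeBaseChange

/-! ### Graded algebras with a splitting -/

section Irrelevant

variable {k : Type w} [CommRing k] {A : Type u} [CommRing A] [Algebra k A]
variable {𝒜 : ℕ → Submodule k A} [GradedAlgebra 𝒜]

theorem mem_irrelevant_iff_component {a : A} :
    a ∈ (HomogeneousIdeal.irrelevant 𝒜).toIdeal ↔ component 𝒜 0 a = 0 :=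
  HomogeneousIdeal.mem_irrelevant_iff 𝒜 a

theorem mem_irrelevant_of_mem {a : A} {d : ℕ} (hd : d ≠ 0) (ha : a ∈ 𝒜 d) :
    a ∈ (HomogeneousIdeal.irrelevant 𝒜).toIdeal :=
  mem_irrelevant_iff_component.mpr (component_of_mem_ne 𝒜 ha hd)

/-- A splitting of `C ⊆ A` can be chosen to map `A₊` to `C₊`. -/
theorem HomogeneousSubalgebra.IsSplit.exists_map_irrelevant {C : HomogeneousSubalgebra 𝒜}
    (h : C.IsSplit) :
    ∃ π : A →ₗ[C.toSubalgebra] C.toSubalgebra, (∀ c : C.toSubalgebra, π (c : A) = c) ∧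
      ∀ a ∈ (HomogeneousIdeal.irrelevant 𝒜).toIdeal,
        π a ∈ (HomogeneousIdeal.irrelevant C.grading).toIdeal := by
  obtain ⟨π, hπ⟩ := h
  -- The degree preserving part of `π`: on degree `d` it is the degree `d` component of `π`. It is
  -- still linear over C and still fixes C.
  let T : A →+ C.toSubalgebra :=
    (DirectSum.toAddMonoid fun d => (component C.grading d).comp
      (π.toAddMonoidHom.comp (𝒜 d).subtype.toAddMonoidHom)).comp
        (decomposeAddEquiv 𝒜).toAddMonoidHom
  have hT : ∀ d, ∀ a ∈ 𝒜 d, T a = component C.grading d (π a) := by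
    intro d a ha
    change DirectSum.toAddMonoid _ (decompose 𝒜 a) = _
    rw [decompose_of_mem 𝒜 ha, DirectSum.toAddMonoid_of]
    rfl
  have hsmul : ∀ (c : C.toSubalgebra) (a : A), T (c • a) = c • T a := by
    intro c a
    induction c using Decomposition.inductionOn C.grading with
    | zero => simp
    | add c c' hc hc' => rw [add_smul, map_add, hc, hc', add_smul]
    | @homogeneous i c =>
      induction a using Decomposition.inductionOn 𝒜 with
      | zero => simp
      | add a a' ha ha' => rw [smul_add, map_add, ha, ha', map_add, smul_add]
      | @homogeneous d a =>
        have hc : ((c : C.toSubalgebra) : A) ∈ 𝒜 i := c.2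
        have hca : (c : C.toSubalgebra) • (a : A) ∈ 𝒜 (i + d) := SetLike.GradedMul.mul_mem hc a.2
        rw [hT d _ a.2, hT (i + d) _ hca, map_smul]
        exact component_smul C.grading C.grading c.2 d _
  refine ⟨{ toFun := T, map_add' := map_add T, map_smul' := hsmul }, fun c => ?_, fun a ha => ?_⟩
  · change T c = c
    induction c using Decomposition.inductionOn C.grading with
    | zero => exact map_zero T
    | add c c' hc hc' => rw [Subalgebra.coe_add, map_add, hc, hc']
    | @homogeneous i c =>
      have hc : ((c : C.toSubalgebra) : A) ∈ 𝒜 i := c.2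
      rw [hT i _ hc, hπ, component_of_mem C.grading c.2]
  · rw [mem_irrelevant_iff_component] at ha ⊢
    change component C.grading 0 (T a) = 0
    rw [← map_component_zero 𝒜 C.grading T (fun d x hx => by
      rw [hT d x hx]; exact component_mem _ _ _), ha, map_zero]

end Irrelevant

/-! ### Base change along a degree preserving ring map. -/

section GradedBaseChange

variable {k : Type w} [CommRing k] {A : Type u} [CommRing A] [Algebra k A]
variable {𝒜 : ℕ → Submodule k A} [GradedAlgebra 𝒜]
variable {R : Type u} [CommRing R] [Algebra k R] {ℛ : ℕ → Submodule k R} [GradedAlgebra ℛ]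
variable [Algebra R A] (hℛ : ∀ d, ∀ r ∈ ℛ d, algebraMap R A r ∈ 𝒜 d)

include hℛ

theorem algebraMap_mem_irrelevant {r : R} (hr : r ∈ (HomogeneousIdeal.irrelevant ℛ).toIdeal) :
    algebraMap R A r ∈ (HomogeneousIdeal.irrelevant 𝒜).toIdeal := by
  rw [mem_irrelevant_iff_component] at hr ⊢
  have := map_component_zero ℛ 𝒜 (algebraMap R A).toAddMonoidHom hℛ 0 r
  rw [hr, map_zero] at this
  exact this.symm

omit [GradedAlgebra 𝒜] [GradedAlgebra ℛ] in
theorem freeInclusion_mem {ι : Type*} {deg : ι → ℕ} {d : ℕ} {x : ι →₀ R}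
    (hx : x ∈ freeGrading ℛ deg d) : freeInclusion A ι x ∈ freeGrading 𝒜 deg d := by
  intro c
  have := hx c
  unfold twist at this ⊢
  split_ifs at this ⊢ with h
  · exact hℛ _ _ this
  · rw [freeInclusion_apply, (Submodule.mem_bot k).mp this, map_zero]
    exact zero_mem _

theorem freeBaseChange_mem {ι ι' : Type u} {φ : (ι →₀ R) →ₗ[R] (ι' →₀ R)} {deg : ι → ℕ}
    {deg' : ι' → ℕ} (hφ : ∀ d, ∀ x ∈ freeGrading ℛ deg d, φ x ∈ freeGrading ℛ deg' d) (d : ℕ)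
    (x : ι →₀ A) (hx : x ∈ freeGrading 𝒜 deg d) :
    freeBaseChange A φ x ∈ freeGrading 𝒜 deg' d := by
  refine linearCombination_mem deg (freeGrading 𝒜 deg') _ (fun c => ?_) hx
  have := single_mem_freeGrading (𝒜 := ℛ) deg c SetLike.GradedOne.one_mem
  rw [zero_add] at this
  exact freeInclusion_mem hℛ (hφ _ _ this)

omit hℛ

omit [Algebra k A] in
/-- Induction for the product of the ideal `R₊ A` with a submodule. -/
theorem map_irrelevant_smul_induction {P : Type*} [AddCommGroup P] [Module A P]
    {Z : Submodule A P} {S : AddSubgroup P}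
    (h : ∀ r ∈ (HomogeneousIdeal.irrelevant ℛ).toIdeal, ∀ z ∈ Z, algebraMap R A r • z ∈ S) {y : P}
    (hy : y ∈ (HomogeneousIdeal.irrelevant ℛ).toIdeal.map (algebraMap R A) • Z) : y ∈ S := by
  induction hy using Submodule.smul_induction_on' with
  | smul a ha z hz =>
    change a ∈ Ideal.span _ at ha
    induction ha using Submodule.span_induction generalizing z with
    | mem a ha =>
      obtain ⟨c, hc, rfl⟩ := ha
      exact h c hc z hz
    | zero => rw [zero_smul]; exact zero_mem _
    | add a b _ _ ha hb => rw [add_smul]; exact add_mem (ha z hz) (hb z hz)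
    | smul b a _ ha =>
      rw [smul_eq_mul, mul_comm, mul_smul]
      exact ha _ (Z.smul_mem b hz)
  | add x _ y _ hx hy => exact add_mem hx hy

end GradedBaseChange

/-! ### The resolution of the residue field, extended to the polynomial ring -/

section Lifting

variable {R : Type*} [CommRing R] {ι : Type*} {P Q : Type*} [AddCommGroup P] [Module R P]
  [AddCommGroup Q] [Module R Q]

theorem exists_lift_free (φ : P →ₗ[R] Q) (ψ : (ι →₀ R) →ₗ[R] Q)
    (h : ∀ x, ψ x ∈ LinearMap.range φ) : ∃ s : (ι →₀ R) →ₗ[R] P, φ ∘ₗ s = ψ := by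
  choose p hp using fun c => h (Finsupp.single c 1)
  refine ⟨Finsupp.linearCombination R p, Finsupp.lhom_ext' fun c => LinearMap.ext_ring ?_⟩
  simp [hp]

end Lifting

/-! ### Null homotopies on a resolution of the residue module, and Tor₀. -/

section Residue

variable {k : Type w} [CommRing k] {A : Type u} [CommRing A] [Algebra k A]
variable {𝒜 : ℕ → Submodule k A} [GradedAlgebra 𝒜]

theorem eq_zero_of_mem_residueGrading {d : ℕ} (hd : d ≠ 0) {x : ResidueModule 𝒜}
    (hx : x ∈ residueGrading 𝒜 d) : x = 0 := by
  obtain ⟨a, ha, rfl⟩ := hx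
  exact Ideal.Quotient.eq_zero_iff_mem.mpr (mem_irrelevant_of_mem hd ha)

theorem smul_residueModule_eq_zero {a : A} (ha : a ∈ (HomogeneousIdeal.irrelevant 𝒜).toIdeal)
    (x : ResidueModule 𝒜) : a • x = 0 := by
  obtain ⟨b, rfl⟩ := Ideal.Quotient.mk_surjective x
  change Ideal.Quotient.mk _ (a * b) = 0
  exact Ideal.Quotient.eq_zero_iff_mem.mpr (Ideal.mul_mem_right _ _ ha)

namespace GradedFreeResolution

variable (F : GradedFreeResolution 𝒜 (residueGrading 𝒜))

theorem coordD_coordD (i : ℕ) (x) : F.coordD i (F.coordD (i + 1) x) = 0 := by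
  rw [← LinearMap.mem_ker, F.ker_coordD]
  exact ⟨x, rfl⟩

theorem exists_homotopy_zero {a : A} (ha : a ∈ (HomogeneousIdeal.irrelevant 𝒜).toIdeal) :
    ∃ s : (F.ι 0 →₀ A) →ₗ[A] (F.ι 1 →₀ A), F.coordD 0 ∘ₗ s = a • LinearMap.id :=
  exists_lift_free (F.coordD 0) (a • LinearMap.id) fun x => by
    rw [← F.ker_coordAug, LinearMap.mem_ker, LinearMap.smul_apply, map_smul]
    exact smul_residueModule_eq_zero ha _

theorem exists_homotopy_of_forall {a : A} {i : ℕ} {t : (F.ι i →₀ A) →ₗ[A] (F.ι (i + 1) →₀ A)}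
    (ht : ∀ x, F.coordD i (t (F.coordD i x)) = a • F.coordD i x) :
    ∃ s : (F.ι (i + 1) →₀ A) →ₗ[A] (F.ι (i + 2) →₀ A),
      F.coordD (i + 1) ∘ₗ s = a • LinearMap.id - t ∘ₗ F.coordD i :=
  exists_lift_free (F.coordD (i + 1)) (a • LinearMap.id - t ∘ₗ F.coordD i) fun x => by
    rw [← F.ker_coordD, LinearMap.mem_ker]
    simp [ht]

/-- Keeping the homotopy identity only on the range of the differential suffices to build the next
homotopy, which satisfies the same identity because the differential squares to zero. The induction
thus carries one map instead of two. -/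
theorem exists_homotopy_on_range {a : A} (ha : a ∈ (HomogeneousIdeal.irrelevant 𝒜).toIdeal)
    (i : ℕ) : ∃ t : (F.ι i →₀ A) →ₗ[A] (F.ι (i + 1) →₀ A),
      ∀ x, F.coordD i (t (F.coordD i x)) = a • F.coordD i x := by
  induction i with
  | zero =>
    obtain ⟨s, hs⟩ := F.exists_homotopy_zero ha
    exact ⟨s, fun x => DFunLike.congr_fun hs (F.coordD 0 x)⟩
  | succ i ih =>
    obtain ⟨t, ht⟩ := ih
    obtain ⟨s, hs⟩ := F.exists_homotopy_of_forall ht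
    refine ⟨s, fun x => (DFunLike.congr_fun hs _).trans ?_⟩
    simp [coordD_coordD]

/-- Multiplication by an element of positive degree on a resolution of the residue module is null
homotopic. -/
theorem exists_homotopy_succ {a : A} (ha : a ∈ (HomogeneousIdeal.irrelevant 𝒜).toIdeal) (i : ℕ) :
    ∃ (t : (F.ι i →₀ A) →ₗ[A] (F.ι (i + 1) →₀ A))
      (s : (F.ι (i + 1) →₀ A) →ₗ[A] (F.ι (i + 2) →₀ A)),
      F.coordD (i + 1) ∘ₗ s + t ∘ₗ F.coordD i = a • LinearMap.id := by
  obtain ⟨t, ht⟩ := F.exists_homotopy_on_range ha i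
  obtain ⟨s, hs⟩ := F.exists_homotopy_of_forall ht
  exact ⟨t, s, LinearMap.ext fun x => eq_sub_iff_add_eq.mp (DFunLike.congr_fun hs x)⟩

/-- The differential of the resolution, after extension of scalars. -/
def extD (S : Type*) [CommRing S] [Algebra A S] {M : Type u} [AddCommGroup M] [Module k M]
    [Module A M] {ℳ : ℕ → Submodule k M} (F : GradedFreeResolution 𝒜 ℳ) (i : ℕ) :
    (F.ι (i + 1) →₀ S) →ₗ[S] (F.ι i →₀ S) :=
  freeBaseChange S (F.coordD i)

variable (S : Type*) [CommRing S] [Algebra A S]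

theorem extD_freeInclusion (i : ℕ) (x : F.ι (i + 1) →₀ A) :
    F.extD S i (freeInclusion S _ x) = freeInclusion S _ (F.coordD i x) :=
  freeBaseChange_freeInclusion S _ x

theorem map_extD (i : ℕ) (π : S →ₗ[A] A) (x : F.ι (i + 1) →₀ S) :
    Finsupp.mapRange.linearMap π (F.extD S i x) = F.coordD i (Finsupp.mapRange.linearMap π x) :=
  map_freeBaseChange _ π x

theorem extD_extD (i : ℕ) (x) : F.extD S i (F.extD S (i + 1) x) = 0 := by
  have h : F.coordD i ∘ₗ F.coordD (i + 1) = 0 := LinearMap.ext (F.coordD_coordD i)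
  have h' := congrArg (freeBaseChange S) h
  rw [freeBaseChange_comp, freeBaseChange_zero] at h'
  exact DFunLike.congr_fun h' x

theorem smul_mem_range_extD_zero {a : A} (ha : a ∈ (HomogeneousIdeal.irrelevant 𝒜).toIdeal)
    (z : F.ι 0 →₀ S) : algebraMap A S a • z ∈ LinearMap.range (F.extD S 0) := by
  obtain ⟨s, hs⟩ := F.exists_homotopy_zero ha
  have h := congrArg (freeBaseChange S) hs
  rw [freeBaseChange_comp, freeBaseChange_smul_id] at h
  exact ⟨_, DFunLike.congr_fun h z⟩

theorem smul_mem_range_extD_succ {a : A} (ha : a ∈ (HomogeneousIdeal.irrelevant 𝒜).toIdeal)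
    (i : ℕ) {z : F.ι (i + 1) →₀ S} (hz : F.extD S i z = 0) :
    algebraMap A S a • z ∈ LinearMap.range (F.extD S (i + 1)) := by
  obtain ⟨t, s, hs⟩ := F.exists_homotopy_succ ha i
  have h := congrArg (freeBaseChange S) hs
  rw [freeBaseChange_add, freeBaseChange_comp _ s, freeBaseChange_comp _ (F.coordD i),
    freeBaseChange_smul_id] at h
  have hz' : freeBaseChange S t (F.extD S i z) = 0 := by
    rw [hz, map_zero]
  have h' := DFunLike.congr_fun h z
  exact ⟨_, Eq.trans (add_eq_left.mpr hz').symm h'⟩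

theorem subsingleton_homology_zero {d : ℕ} (hd : d ≠ 0) :
    Subsingleton (F.Homology (residueGrading 𝒜) 0 d) := by
  rw [F.subsingleton_homology_zero_iff]
  intro x hx
  obtain ⟨y, hy⟩ : x ∈ LinearMap.range (F.coordD 0) := by
    rw [← F.ker_coordAug]
    exact eq_zero_of_mem_residueGrading hd (F.coordAug_mem d x hx)
  exact ⟨y, by rw [hy, sub_self]; exact zero_mem _⟩

/-- The augmentation kills the boundaries and A₊F₀, but not a degree 0 lift of 1. -/
theorem nontrivial_homology_zero [Nontrivial (ResidueModule 𝒜)] :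
    Nontrivial (F.Homology (residueGrading 𝒜) 0 0) := by
  rw [← not_subsingleton_iff_nontrivial, F.subsingleton_homology_zero_iff]
  intro h
  obtain ⟨x, hx, hx1⟩ := exists_mem_of_mem_range (freeGrading 𝒜 (F.deg 0)) (residueGrading 𝒜)
    F.coordAug F.coordAug_mem (F.coordAug_surjective 1)
    (show (1 : ResidueModule 𝒜) ∈ residueGrading 𝒜 0 from ⟨1, SetLike.GradedOne.one_mem, rfl⟩)
  obtain ⟨y, hy⟩ := h x hx
  have h0 : ∀ z ∈ coordIdeal (HomogeneousIdeal.irrelevant 𝒜).toIdeal (F.ι 0),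
      F.coordAug z = 0 := by
    intro z hz
    rw [coordIdeal_eq_smul_top] at hz
    refine Submodule.smul_induction_on hz (fun a ha z _ => ?_) fun x y hx hy => ?_
    · rw [map_smul]
      exact smul_residueModule_eq_zero ha _
    · rw [map_add, hx, hy, add_zero]
  have hy0 : F.coordAug (F.coordD 0 y) = 0 := by
    rw [← LinearMap.mem_ker, F.ker_coordAug]
    exact ⟨y, rfl⟩
  have := h0 _ hy
  rw [map_sub, hx1, hy0, sub_zero] at this
  exact one_ne_zero this

end GradedFreeResolution

end Residue

/-! ### The complex extended to the polynomial ring: cycles, homology and generators. -/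

section Extended

open MvPolynomial

variable {n : ℕ} {k : Type u} [Field k]
variable {R : Type u} [CommRing R] [Algebra k R] {ℛ : ℕ → Submodule k R} [GradedAlgebra ℛ]
variable [Algebra R (MvPolynomial (Fin n) k)]
variable (F : GradedFreeResolution ℛ (residueGrading ℛ))
variable (hℛ : ∀ d, ∀ r ∈ ℛ d,
  algebraMap R (MvPolynomial (Fin n) k) r ∈ homogeneousSubmodule (Fin n) k d)

namespace GradedFreeResolution

/-- The cycles of the extended complex. -/
def extCycles : ∀ i, Submodule (MvPolynomial (Fin n) k) (F.ι i →₀ MvPolynomial (Fin n) k)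
  | 0 => ⊤
  | i + 1 => LinearMap.ker (F.extD (MvPolynomial (Fin n) k) i)

/-- The grading of the terms of the extended complex. -/
abbrev extGrading (i : ℕ) : ℕ → Submodule k (F.ι i →₀ MvPolynomial (Fin n) k) :=
  freeGrading (homogeneousSubmodule (Fin n) k) (F.deg i)

include hℛ in
theorem extD_mem (i d : ℕ) (x) (hx : x ∈ F.extGrading (i + 1) d) :
    F.extD (MvPolynomial (Fin n) k) i x ∈ F.extGrading i d :=
  freeBaseChange_mem hℛ (F.coordD_mem i) d x hx

theorem range_extD_le (i : ℕ) :
    LinearMap.range (F.extD (MvPolynomial (Fin n) k) i) ≤ F.extCycles i := by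
  cases i with
  | zero => exact le_top
  | succ i =>
    rintro _ ⟨x, rfl⟩
    exact F.extD_extD _ i x

include hℛ in
theorem isHomogeneous_extCycles (i : ℕ) :
    (F.extCycles (n := n) i).IsHomogeneous (F.extGrading i) := by
  cases i with
  | zero => exact isHomogeneous_top _
  | succ i => exact isHomogeneous_ker _ _ _ (F.extD_mem hℛ i)

/-- The homology of the extended complex is annihilated by `C₊`. -/
theorem map_irrelevant_smul_extCycles_le (i : ℕ) :
    (HomogeneousIdeal.irrelevant ℛ).toIdeal.map (algebraMap R (MvPolynomial (Fin n) k)) •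
      F.extCycles i ≤ LinearMap.range (F.extD (MvPolynomial (Fin n) k) i) := by
  intro y hy
  refine map_irrelevant_smul_induction
    (S := (LinearMap.range (F.extD (MvPolynomial (Fin n) k) i)).toAddSubgroup)
    (fun c hc z hz => ?_) hy
  cases i with
  | zero => exact F.smul_mem_range_extD_zero _ hc z
  | succ i => exact F.smul_mem_range_extD_succ _ hc i hz

/-- H₀ is B ⊗ k = B/I. Basis elements of nonzero degree are killed by the augmentation and so are
boundaries; on those of degree 0 an element of degree `a + 1` has coefficients without constant
term. -/
theorem generatedUpTo_zero :
    GeneratedUpTo (F.extGrading 0) (F.extCycles 0)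
      (LinearMap.range (F.extD (MvPolynomial (Fin n) k) 0)) 0 := by
  classical
  intro a _ x _ hxa
  rw [← Finsupp.filter_add_filter_not x fun c => F.deg 0 c = 0]
  refine add_mem (AddSubgroup.mem_sup_right (mem_mulSpan_top (fun c => ?_) fun c => ?_))
    (AddSubgroup.mem_sup_left ?_)
  · rw [mem_irrelevant_iff_coeff, Finsupp.filter_apply]
    split_ifs with h
    · exact coeff_zero_of_mem_freeGrading hxa (by omega)
    · exact coeff_zero 0
  · rw [Finsupp.filter_apply]
    split_ifs with h
    · exact hxa c
    · exact zero_mem _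
  · rw [← Finsupp.sum_single (Finsupp.filter _ x)]
    refine sum_mem fun c hc => ?_
    have hc0 : F.deg 0 c ≠ 0 := (Finsupp.mem_support_iff.mp hc |> fun h h0 => h (by
      rw [Finsupp.filter_apply, if_neg (not_not.mpr h0)]))
    rw [single_eq_smul_freeInclusion R]
    refine Submodule.smul_mem _ _ ?_
    have h1 := single_mem_freeGrading (𝒜 := ℛ) (F.deg 0) c SetLike.GradedOne.one_mem
    rw [zero_add] at h1
    obtain ⟨y, hy⟩ : Finsupp.single c 1 ∈ LinearMap.range (F.coordD 0) := by
      rw [← F.ker_coordAug]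
      exact eq_zero_of_mem_residueGrading hc0 (F.coordAug_mem _ _ h1)
    exact ⟨freeInclusion (MvPolynomial (Fin n) k) _ y, by rw [extD_freeInclusion, hy]⟩

/-- In degrees above `τ`, the cycles with coordinates of positive degree are not minimal
generators of the module of cycles. -/
def PositiveCyclesBound (i τ : ℕ) : Prop :=
  ∀ a, τ ≤ a → ∀ z ∈ F.extCycles i, z ∈ coordIdeal (HomogeneousIdeal.irrelevant
      (homogeneousSubmodule (Fin n) k)).toIdeal (F.ι i) →
    z ∈ F.extGrading i (a + 1) → z ∈ mulSpan (F.extGrading i) (F.extCycles i) 1 a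

omit F in
/-- A homogeneous element of a free module over the polynomial ring comes from `C`, up to
coordinates of positive degree. -/
theorem exists_sub_freeInclusion_mem [IsScalarTower k R (MvPolynomial (Fin n) k)] {ι : Type u}
    {deg : ι → ℕ} {d : ℕ}
    {z : ι →₀ MvPolynomial (Fin n) k}
    (hz : z ∈ freeGrading (homogeneousSubmodule (Fin n) k) deg d) :
    ∃ z' ∈ freeGrading ℛ deg d, z - freeInclusion (MvPolynomial (Fin n) k) _ z' ∈
      coordIdeal (HomogeneousIdeal.irrelevant (homogeneousSubmodule (Fin n) k)).toIdeal ι := by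
  refine ⟨z.mapRange (fun p => algebraMap k R (coeff 0 p)) (by simp), ?_, ?_⟩
  · intro c
    by_cases hc : deg c = d
    · rw [twist, if_pos hc.le, hc, Nat.sub_self]
      exact SetLike.algebraMap_mem_graded ℛ _
    · rw [Finsupp.mapRange_apply, coeff_zero_of_mem_freeGrading hz hc, map_zero]
      exact zero_mem _
  · intro c
    rw [mem_irrelevant_iff_coeff]
    change coeff 0 (z c - algebraMap R _ (algebraMap k R (coeff 0 (z c)))) = 0
    rw [← IsScalarTower.algebraMap_apply, algebraMap_eq, coeff_sub, coeff_C, if_pos rfl, sub_self]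

include hℛ in
-- Up to coordinates of positive degree a cycle `z` comes from an element `z'` over C, which is a
-- cycle for Tor^C(k, k). Where that Tor vanishes, `z` agrees with a boundary up to coordinates of
-- positive degree, and `hP` handles the difference.
theorem generatedUpTo_succ [IsScalarTower k R (MvPolynomial (Fin n) k)] {i τ : ℕ}
    (π : MvPolynomial (Fin n) k →ₗ[R] R)
    (hπ : ∀ r, π (algebraMap R _ r) = r)
    (hπ' : ∀ b ∈ (HomogeneousIdeal.irrelevant (homogeneousSubmodule (Fin n) k)).toIdeal,
      π b ∈ (HomogeneousIdeal.irrelevant ℛ).toIdeal)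
    (hP : F.PositiveCyclesBound (n := n) (i + 1) τ)
    (hT : ∀ d, τ < d → Subsingleton (F.Homology (residueGrading ℛ) (i + 1) d)) :
    GeneratedUpTo (F.extGrading (i + 1)) (F.extCycles (i + 1))
      (LinearMap.range (F.extD (MvPolynomial (Fin n) k) (i + 1))) τ := by
  intro a ha z hz hza
  obtain ⟨z', hz', hzz'⟩ := exists_sub_freeInclusion_mem (ℛ := ℛ) hza
  have hz0 : F.extD (MvPolynomial (Fin n) k) i z = 0 := hz
  -- Over B the coordinates are in B₊ because `z` is a cycle; the splitting, which maps B₊ to C₊,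
  -- brings this back to C.
  have hDz : F.coordD i z' ∈ coordIdeal (HomogeneousIdeal.irrelevant ℛ).toIdeal (F.ι i) := by
    have h1 := neg_mem (map_mem_coordIdeal _ (F.extD (MvPolynomial (Fin n) k) i) hzz')
    rw [map_sub, hz0, zero_sub, neg_neg, extD_freeInclusion] at h1
    intro c
    rw [← hπ (F.coordD i z' c)]
    exact hπ' _ (h1 c)
  obtain ⟨y, hy⟩ := (F.subsingleton_homology_succ_iff i (a + 1)).mp (hT _ (by omega)) z' hz' hDz
  have hy' : freeInclusion (MvPolynomial (Fin n) k) _ z' -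
      F.extD (MvPolynomial (Fin n) k) (i + 1) (freeInclusion (MvPolynomial (Fin n) k) _ y) ∈
      coordIdeal (HomogeneousIdeal.irrelevant (homogeneousSubmodule (Fin n) k)).toIdeal
        (F.ι (i + 1)) := by
    rw [extD_freeInclusion, ← map_sub]
    exact fun c => algebraMap_mem_irrelevant hℛ (hy c)
  have hsum : z - F.extD (MvPolynomial (Fin n) k) (i + 1)
      (freeInclusion (MvPolynomial (Fin n) k) _ y) ∈ coordIdeal (HomogeneousIdeal.irrelevant
        (homogeneousSubmodule (Fin n) k)).toIdeal (F.ι (i + 1)) := by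
    rw [← sub_add_sub_cancel z (freeInclusion (MvPolynomial (Fin n) k) _ z')]
    exact add_mem hzz' hy'
  -- The element `y` need not be homogeneous, so the boundary is replaced by its component in the
  -- degree of `z`.
  obtain ⟨w, hw⟩ : ∃ w, w = component (F.extGrading (i + 1)) (a + 1)
    (F.extD (MvPolynomial (Fin n) k) (i + 1) (freeInclusion (MvPolynomial (Fin n) k) _ y)) :=
      ⟨_, rfl⟩
  have hwr : w ∈ LinearMap.range (F.extD (MvPolynomial (Fin n) k) (i + 1)) := by
    rw [hw]
    exact isHomogeneous_range _ _ _ (F.extD_mem hℛ (i + 1)) (a + 1) ⟨_, rfl⟩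
  have hwa : w ∈ F.extGrading (i + 1) (a + 1) := by
    rw [hw]
    exact component_mem _ _ _
  have hsum' := component_mem_coordIdeal (F.deg (i + 1)) a hsum
  rw [map_sub, component_of_mem _ hza, ← hw] at hsum'
  rw [← add_sub_cancel w z]
  exact add_mem (AddSubgroup.mem_sup_left hwr) (AddSubgroup.mem_sup_right
    (hP a ha _ (sub_mem hz (F.range_extD_le _ hwr)) hsum' (sub_mem hza hwa)))

include hℛ in
/-- A bound for the generators of the cycles bounds the degrees of the next Tor module. -/
theorem subsingleton_homology_of_positiveCyclesBound {i τ e d : ℕ}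
    (π : MvPolynomial (Fin n) k →ₗ[R] R) (hπ : ∀ r, π (algebraMap R _ r) = r)
    (hI : ∀ m, e < m → ∀ b ∈ homogeneousSubmodule (Fin n) k m,
      b ∈ (HomogeneousIdeal.irrelevant ℛ).toIdeal.map (algebraMap R (MvPolynomial (Fin n) k)))
    (hP : F.PositiveCyclesBound (n := n) (i + 1) τ) (hd : τ + e < d) :
    Subsingleton (F.Homology (residueGrading ℛ) (i + 2) d) := by
  rw [F.subsingleton_homology_succ_iff]
  intro x hx hdx
  have hxI : freeInclusion (MvPolynomial (Fin n) k) _ (F.coordD (i + 1) x) ∈ coordIdeal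
      ((HomogeneousIdeal.irrelevant ℛ).toIdeal.map (algebraMap R (MvPolynomial (Fin n) k)))
      (F.ι (i + 1)) := fun c => Ideal.mem_map_of_mem _ (hdx c)
  have hxZ : freeInclusion (MvPolynomial (Fin n) k) _ (F.coordD (i + 1) x) ∈
      F.extCycles (i + 1) := by
    change F.extD _ i _ = 0
    rw [extD_freeInclusion, coordD_coordD, map_zero]
  -- The differential of `x` is a cycle with coordinates in I, in a degree where this forces it into
  -- I times the cycles.
  have hmem := mem_ideal_smul_of_mem_coordIdeal hP hI hd hxZ hxI
    (freeInclusion_mem hℛ (F.coordD_mem (i + 1) d x hx))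
  -- The splitting sends I times the cycles of the extended complex into C₊ times the range of the
  -- differential over C, since cycles map to cycles and F is exact.
  let S : AddSubgroup (F.ι (i + 1) →₀ MvPolynomial (Fin n) k) :=
    (((HomogeneousIdeal.irrelevant ℛ).toIdeal •
      LinearMap.range (F.coordD (i + 1))).toAddSubgroup).comap
        (Finsupp.mapRange.linearMap π).toAddMonoidHom
  have hS := map_irrelevant_smul_induction (S := S) (fun r hr z hz => ?_) hmem
  · have hπx : Finsupp.mapRange.linearMap π
        (freeInclusion (MvPolynomial (Fin n) k) _ (F.coordD (i + 1) x)) = F.coordD (i + 1) x :=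
      Finsupp.ext fun c => hπ _
    change Finsupp.mapRange.linearMap π _ ∈ (HomogeneousIdeal.irrelevant ℛ).toIdeal •
      LinearMap.range (F.coordD (i + 1)) at hS
    rw [hπx, ← Submodule.map_top, ← Submodule.map_smul''] at hS
    obtain ⟨y, hy, hxy⟩ := hS
    have hker : x - y ∈ LinearMap.ker (F.coordD (i + 1)) := by
      rw [LinearMap.mem_ker, map_sub, hxy, sub_self]
    rw [F.ker_coordD] at hker
    obtain ⟨w, hw⟩ := hker
    refine ⟨w, ?_⟩
    rw [hw, sub_sub_cancel, coordIdeal_eq_smul_top]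
    exact hy
  · change Finsupp.mapRange.linearMap π (algebraMap R (MvPolynomial (Fin n) k) r • z) ∈
      (HomogeneousIdeal.irrelevant ℛ).toIdeal • LinearMap.range (F.coordD (i + 1))
    rw [algebraMap_smul, map_smul]
    refine Submodule.smul_mem_smul hr ?_
    rw [← F.ker_coordD, LinearMap.mem_ker, ← F.map_extD,
      show F.extD (MvPolynomial (Fin n) k) i z = 0 from hz, map_zero]

include hℛ in
-- The differential of `x` is a combination of the variables with coefficients of degree `d - 1 >
-- e`. These coefficients are boundaries because H₀ vanishes there. Hence the differential of `x` is
-- that of an element with coordinates in B₊, and the splitting moves this element to C₊F₁.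
theorem subsingleton_homology_one {e d : ℕ} (π : MvPolynomial (Fin n) k →ₗ[R] R)
    (hπ : ∀ r, π (algebraMap R _ r) = r)
    (hπ' : ∀ b ∈ (HomogeneousIdeal.irrelevant (homogeneousSubmodule (Fin n) k)).toIdeal,
      π b ∈ (HomogeneousIdeal.irrelevant ℛ).toIdeal)
    (hI : ∀ m, e < m → ∀ b ∈ homogeneousSubmodule (Fin n) k m,
      b ∈ (HomogeneousIdeal.irrelevant ℛ).toIdeal.map (algebraMap R (MvPolynomial (Fin n) k)))
    (hd : e + 1 < d) : Subsingleton (F.Homology (residueGrading ℛ) 1 d) := by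
  rw [F.subsingleton_homology_succ_iff]
  intro x hx hdx
  obtain ⟨a, rfl⟩ : ∃ a, d = a + 1 := ⟨d - 1, by omega⟩
  obtain ⟨s⟩ := koszulIndex_zero_nonempty n
  obtain ⟨g, hg⟩ := koszul_exact_free_zero (ι := F.ι 0)
    (fun _ => freeInclusion (MvPolynomial (Fin n) k) _ (F.coordD 0 x))
    fun _ c => algebraMap_mem_irrelevant hℛ (hdx c)
  obtain ⟨g, -, hga, hg⟩ := exists_homogeneous_primitive_eq
    (isHomogeneous_top (A := MvPolynomial (Fin n) k) (F.extGrading 0))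
    (fun _ => freeInclusion_mem hℛ (F.coordD_mem 0 _ x hx)) (fun _ => trivial) hg
  choose p hp using fun t => F.generatedUpTo_zero.mem_of_lt
    (F.map_irrelevant_smul_extCycles_le 0) hI (a := a) (by omega) (g t) trivial (hga t)
  have hu : F.extD (MvPolynomial (Fin n) k) 0 (koszulD (varSeq n k) n 0 p s) =
      freeInclusion (MvPolynomial (Fin n) k) _ (F.coordD 0 x) := by
    rw [koszulD_linearMap, ← congrFun hg s]
    congr 1
    exact funext hp
  have hπu := congrArg (Finsupp.mapRange.linearMap π) hu
  have hπx : Finsupp.mapRange.linearMap π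
      (freeInclusion (MvPolynomial (Fin n) k) _ (F.coordD 0 x)) = F.coordD 0 x :=
    Finsupp.ext fun c => hπ _
  rw [F.map_extD, hπx] at hπu
  have hker : x - Finsupp.mapRange.linearMap π (koszulD (varSeq n k) n 0 p s) ∈
      LinearMap.ker (F.coordD 0) := by
    rw [LinearMap.mem_ker, map_sub, hπu, sub_self]
  rw [F.ker_coordD] at hker
  obtain ⟨w, hw⟩ := hker
  refine ⟨w, ?_⟩
  rw [hw, sub_sub_cancel]
  have hmem := koszulD_mem_irrelevant_smul (n := n) (k := k) ⊤ (f := p) (fun _ => trivial) s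
  rw [← coordIdeal_eq_smul_top] at hmem
  exact fun c => hπ' _ (hmem c)

end GradedFreeResolution

end Extended

/-! ### Bounds for the Tor modules of the residue module -/

section Bounds

open MvPolynomial

variable {n : ℕ} {k : Type u} [Field k]
variable {R : Type u} [CommRing R] [Algebra k R] {ℛ : ℕ → Submodule k R} [GradedAlgebra ℛ]
variable [Algebra R (MvPolynomial (Fin n) k)]
variable (F : GradedFreeResolution ℛ (residueGrading ℛ))
variable (hℛ : ∀ d, ∀ r ∈ ℛ d,
  algebraMap R (MvPolynomial (Fin n) k) r ∈ homogeneousSubmodule (Fin n) k d)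

namespace GradedFreeResolution

variable (n) in
/-- The vanishing of the Koszul homology of the boundaries of the extended complex. -/
abbrev BoundaryKoszulVanishes (i j a : ℕ) : Prop :=
  KoszulVanishes (F.extGrading i) (LinearMap.range (F.extD (MvPolynomial (Fin n) k) i)) ⊥ j a

include hℛ in
-- Tor₁(Eᵢ, k) is the kernel of Zᵢ₊₁ ⊗ k → Fᵢ₊₁ ⊗ k. The shift by one arises because Koszul
-- coefficients of degree `a + 1` in homological degree one have total degree `a + 2`.
theorem positiveCyclesBound_succ {i τ : ℕ} (h : ∀ a, τ ≤ a → F.BoundaryKoszulVanishes n i 0 a) :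
    F.PositiveCyclesBound (n := n) (i + 1) (τ + 1) := by
  intro a ha z hz hz0 hza
  obtain ⟨a, rfl⟩ : ∃ b, a = b + 1 := ⟨a - 1, by omega⟩
  exact (h a (by omega)).mem_mulSpan_ker _ (F.extD_mem hℛ i) hz hz0 hza

include hℛ in
theorem BoundaryKoszulVanishes.extCycles_succ {i j a : ℕ}
    (h : F.BoundaryKoszulVanishes n i (j + 1) a) :
    KoszulVanishes (F.extGrading (i + 1)) (F.extCycles (n := n) (i + 1)) ⊥ j (a + 1) :=
  KoszulVanishes.ker _ (F.extD_mem hℛ i) h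

variable [IsScalarTower k R (MvPolynomial (Fin n) k)] {e : ℕ}
variable (π : MvPolynomial (Fin n) k →ₗ[R] R) (hπ : ∀ r, π (algebraMap R _ r) = r)
variable (hπ' : ∀ b ∈ (HomogeneousIdeal.irrelevant (homogeneousSubmodule (Fin n) k)).toIdeal,
  π b ∈ (HomogeneousIdeal.irrelevant ℛ).toIdeal)
variable (hI : ∀ m, e < m → ∀ b ∈ homogeneousSubmodule (Fin n) k m,
  b ∈ (HomogeneousIdeal.irrelevant ℛ).toIdeal.map (algebraMap R (MvPolynomial (Fin n) k)))

include hℛ hπ hπ' hI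

/-- The two claims feed each other. Together they show that Hᵢ₊₁ is generated in degrees at most
(e+2)(i+1), hence vanishes above (e+2)(i+1) + e; with the vanishing for Zᵢ₊₁ this gives the first
claim for i + 1. The first claim for i also bounds Torᵢ₊₂. -/
theorem boundaryKoszulVanishes_and_subsingleton (i : ℕ) :
    (∀ j a, e + 1 + (e + 2) * i ≤ a → F.BoundaryKoszulVanishes n i j a) ∧
    ∀ d, e + 1 + (e + 2) * i + 1 < d →
      Subsingleton (F.Homology (residueGrading ℛ) (i + 1) d) := by
  induction i with
  | zero =>
    refine ⟨fun j a ha => ?_, fun d hd => F.subsingleton_homology_one hℛ π hπ hπ' hI (by omega)⟩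
    obtain ⟨a, rfl⟩ : ∃ b, a = b + 1 := ⟨a - 1, by omega⟩
    exact (koszulVanishes_free _ j (a + 1)).sub (F.isHomogeneous_extCycles hℛ 0)
      (F.range_extD_le 0) (koszulVanishes_of_le (F.generatedUpTo_zero.mem_of_lt
        (F.map_irrelevant_smul_extCycles_le 0) hI (by omega)) _)
  | succ i ih =>
    obtain ⟨hV, hT⟩ := ih
    have hP := F.positiveCyclesBound_succ hℛ (hV 0)
    have hG := F.generatedUpTo_succ hℛ π hπ hπ' hP hT
    rw [Nat.mul_succ]
    refine ⟨fun j a ha => ?_, fun d hd => F.subsingleton_homology_of_positiveCyclesBound hℛ π hπ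
      hI hP (by omega)⟩
    obtain ⟨a, rfl⟩ : ∃ b, a = b + 1 := ⟨a - 1, by omega⟩
    exact (BoundaryKoszulVanishes.extCycles_succ F hℛ (hV (j + 1) a (by omega))).sub
      (F.isHomogeneous_extCycles hℛ (i + 1)) (F.range_extD_le (i + 1))
      (koszulVanishes_of_le (hG.mem_of_lt
        (F.map_irrelevant_smul_extCycles_le (i + 1)) hI (by omega)) _)

/-- Only the vanishing for boundaries is taken from the induction: it gives τ = (e+2)(i+1), and τ +
e = (e+2)(i+2) - 2 improves by two on the Tor bound carried there. -/
theorem subsingleton_homology_add_two (i : ℕ) {d : ℕ} (hd : (e + 2) * (i + 2) < d + 2) :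
    Subsingleton (F.Homology (residueGrading ℛ) (i + 2) d) := by
  refine F.subsingleton_homology_of_positiveCyclesBound hℛ π hπ hI (F.positiveCyclesBound_succ hℛ
    ((F.boundaryKoszulVanishes_and_subsingleton hℛ π hπ hπ' hI i).1 0)) ?_
  rw [mul_add] at hd
  omega

variable (hV : ∀ f : KoszulIndex n 2 → MvPolynomial (Fin n) k,
  (∀ s, f s ∈ homogeneousSubmodule (Fin n) k e) →
  ∃ g : KoszulIndex n 3 → MvPolynomial (Fin n) k, ∀ s, f s - koszulD (varSeq n k) n 2 g s ∈
    (HomogeneousIdeal.irrelevant ℛ).toIdeal.map (algebraMap R (MvPolynomial (Fin n) k)))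

include hV

/-- Every homological degree obeys the bound coming from the top degree of Hᵢ. For the first Koszul
homology of the boundaries, `hV` gains one more degree, because Tor₂(Hᵢ, k) vanishes also in the
extreme degree. Only this first homology enters the bound on generators. -/
theorem boundaryKoszulVanishes_and_subsingleton_of_koszul (he : 1 ≤ e) (i : ℕ) :
    (∀ j a, e + (e + 1) * i + 1 ≤ a → F.BoundaryKoszulVanishes n i j a) ∧
    F.BoundaryKoszulVanishes n i 0 (e + (e + 1) * i) ∧
    ∀ d, e + (e + 1) * i + 1 < d →
      Subsingleton (F.Homology (residueGrading ℛ) (i + 1) d) := by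
  induction i with
  | zero =>
    refine ⟨fun j a ha => ?_, ?_, fun d hd =>
      F.subsingleton_homology_one hℛ π hπ hπ' hI (by omega)⟩
    · exact (F.boundaryKoszulVanishes_and_subsingleton hℛ π hπ hπ' hI 0).1 j a (by omega)
    · obtain ⟨a, rfl⟩ : ∃ b, e = b + 1 := ⟨e - 1, by omega⟩
      exact (koszulVanishes_free _ 0 (a + 1)).sub (F.isHomogeneous_extCycles hℛ 0)
        (F.range_extD_le 0) (F.generatedUpTo_zero.koszulVanishes
          (F.map_irrelevant_smul_extCycles_le 0) hV (by omega))
  | succ i ih =>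
    obtain ⟨hV₁, hV₀, hT⟩ := ih
    have hP := F.positiveCyclesBound_succ hℛ (τ := e + (e + 1) * i) fun a ha => by
      obtain rfl | ha := ha.eq_or_lt
      exacts [hV₀, hV₁ 0 a ha]
    have hG := F.generatedUpTo_succ hℛ π hπ hπ' hP hT
    rw [Nat.mul_succ]
    refine ⟨fun j a ha => ?_, ?_, fun d hd => F.subsingleton_homology_of_positiveCyclesBound hℛ
      π hπ hI hP (by omega)⟩
    · obtain ⟨a, rfl⟩ : ∃ b, a = b + 1 := ⟨a - 1, by omega⟩
      exact (BoundaryKoszulVanishes.extCycles_succ F hℛ (hV₁ (j + 1) a (by omega))).sub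
        (F.isHomogeneous_extCycles hℛ (i + 1)) (F.range_extD_le (i + 1))
        (koszulVanishes_of_le (hG.mem_of_lt
          (F.map_irrelevant_smul_extCycles_le (i + 1)) hI (by omega)) _)
    -- Here `1 ≤ e` is needed: the second Koszul homology of Eᵢ has no gained degree, and for `e =
    -- 0` its bound would miss by one.
    · have ha : e + (e + 1) * i + 1 ≤ e + (e + 1) * i + e := by omega
      have := (BoundaryKoszulVanishes.extCycles_succ F hℛ (hV₁ 1 _ ha)).sub
        (F.isHomogeneous_extCycles hℛ (i + 1)) (F.range_extD_le (i + 1))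
        (hG.koszulVanishes (F.map_irrelevant_smul_extCycles_le (i + 1)) hV (by omega))
      rwa [show e + ((e + 1) * i + (e + 1)) = e + (e + 1) * i + e + 1 by omega]

omit hπ hπ' hI [IsScalarTower k R (MvPolynomial (Fin n) k)] in
/-- If the second Koszul homology of `B ⧸ I` vanishes in degree zero, there is at most one
variable. -/
theorem isEmpty_koszulIndex_two (he : e = 0) : IsEmpty (KoszulIndex n 2) := by
  refine ⟨fun s => ?_⟩
  -- Modulo B₊ both I and all Koszul boundaries vanish, while the chain with constant value 1 does
  -- not.
  obtain ⟨g, hg⟩ := hV (fun _ => 1) fun _ => he ▸ isHomogeneous_one _ _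
  have h1 : (1 : MvPolynomial (Fin n) k) - koszulD (varSeq n k) n 2 g s ∈
      (HomogeneousIdeal.irrelevant (homogeneousSubmodule (Fin n) k)).toIdeal :=
    (Ideal.map_le_iff_le_comap.mpr fun r hr => Ideal.mem_comap.mpr
      (algebraMap_mem_irrelevant hℛ hr)) (hg s)
  have h2 := koszulD_mem_irrelevant_smul (n := n) (k := k)
    (⊤ : Submodule (MvPolynomial (Fin n) k) (MvPolynomial (Fin n) k)) (f := g)
    (fun _ => trivial) s
  rw [smul_eq_mul, Ideal.mul_top] at h2
  have h3 := add_mem h1 h2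
  rw [sub_add_cancel, mem_irrelevant_iff_coeff, coeff_zero_one] at h3
  exact one_ne_zero h3

/-- For `e = 0` there are no Koszul generators in degree two, so the first Koszul homology of the
boundaries vanishes outright and the bound holds with τ = 1. -/
theorem subsingleton_homology_add_two_of_koszul (i : ℕ) {d : ℕ}
    (hd : (e + 1) * (i + 2) < d + 1) :
    Subsingleton (F.Homology (residueGrading ℛ) (i + 2) d) := by
  rw [mul_add] at hd
  obtain he | he := Nat.eq_zero_or_pos e
  · have := isEmpty_koszulIndex_two hℛ hV he
    refine F.subsingleton_homology_of_positiveCyclesBound hℛ π hπ hI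
      (F.positiveCyclesBound_succ hℛ (τ := 0) fun a _ =>
        koszulVanishes_zero_of_isEmpty _ _ a) ?_
    subst he
    omega
  · obtain ⟨hV₁, hV₀, -⟩ :=
      F.boundaryKoszulVanishes_and_subsingleton_of_koszul hℛ π hπ hπ' hI hV he i
    refine F.subsingleton_homology_of_positiveCyclesBound hℛ π hπ hI
      (F.positiveCyclesBound_succ hℛ (τ := e + (e + 1) * i) fun a ha => ?_) (by omega)
    obtain rfl | ha := ha.eq_or_lt
    exacts [hV₀, hV₁ 0 a ha]

end GradedFreeResolution

end Bounds

/-! ### The end of a graded module -/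

theorem gradedEnd_le_iff {X : ℕ → Type*} {b : EReal} :
    gradedEnd X ≤ b ↔ ∀ d, Nontrivial (X d) → (d : EReal) ≤ b :=
  iSup₂_le_iff

theorem le_gradedEnd {X : ℕ → Type*} (d : ℕ) [h : Nontrivial (X d)] : (d : EReal) ≤ gradedEnd X :=
  le_iSup₂ (f := fun (d : ℕ) (_ : Nontrivial (X d)) => (d : EReal)) d h

theorem gradedEnd_le_natCast {X : ℕ → Type*} {b : ℕ} (h : ∀ d, b < d → Subsingleton (X d)) :
    gradedEnd X ≤ b := by
  rw [gradedEnd_le_iff]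
  intro d hd
  by_contra hb
  exact not_subsingleton_iff_nontrivial.mpr hd (h d (not_le.mp fun hdb =>
    hb (by exact_mod_cast hdb)))

theorem subsingleton_of_gradedEnd_lt {X : ℕ → Type*} {d : ℕ} (h : gradedEnd X < d) :
    Subsingleton (X d) := by
  rw [← not_nontrivial_iff_subsingleton]
  exact fun hd => h.not_ge (le_gradedEnd d)

/-- Being nonzero in degree 0 excludes the value -∞. -/
theorem gradedEnd_eq_natCast_or_top {X : ℕ → Type*} (h : Nontrivial (X 0)) :
    gradedEnd X = ⊤ ∨ ∃ N : ℕ, gradedEnd X = N := by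
  classical
  by_cases hb : ∃ N, ∀ d, Nontrivial (X d) → d ≤ N
  · right
    obtain ⟨N, hN⟩ := hb
    have hs : Nontrivial (X (Nat.findGreatest (fun d => Nontrivial (X d)) N)) :=
      Nat.findGreatest_spec (P := fun d => Nontrivial (X d)) (Nat.zero_le N) h
    refine ⟨Nat.findGreatest (fun d => Nontrivial (X d)) N, le_antisymm ?_ (le_gradedEnd _)⟩
    rw [gradedEnd_le_iff]
    exact fun d hd => by exact_mod_cast Nat.le_findGreatest (hN d hd) hd
  · left
    push Not at hb
    rw [EReal.eq_top_iff_forall_lt]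
    intro y
    obtain ⟨N, hN⟩ := exists_nat_gt y
    obtain ⟨d, hd, hNd⟩ := hb N
    refine lt_of_lt_of_le ?_ (le_gradedEnd d)
    have : y < (d : ℝ) := hN.trans (by exact_mod_cast hNd)
    exact_mod_cast this

theorem EReal.natCast_sub_of_le {a b : ℕ} (h : b ≤ a) : ((a - b : ℕ) : EReal) = a - b := by
  rw [← EReal.coe_coe_eq_natCast, Nat.cast_sub h]
  rfl

theorem HomogeneousIdeal.mem_of_subsingleton_quotientGrading {k : Type w} [CommRing k] {A : Type u}
    [CommRing A] [Algebra k A] {𝒜 : ℕ → Submodule k A} [GradedAlgebra 𝒜]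
    {I : HomogeneousIdeal 𝒜} {d : ℕ} (h : Subsingleton (I.quotientGrading d)) {b : A}
    (hb : b ∈ 𝒜 d) : b ∈ I.toIdeal := by
  rw [← Ideal.Quotient.eq_zero_iff_mem]
  exact congrArg Subtype.val (Subsingleton.elim
    (⟨Ideal.Quotient.mk I.toIdeal b, b, hb, rfl⟩ : I.quotientGrading d) 0)

/-! ### Nontriviality in degree zero and the value of t₀. -/

namespace HomogeneousSubalgebra

variable {k : Type u} [Field k] {n : ℕ}
variable (C : HomogeneousSubalgebra (MvPolynomial.homogeneousSubmodule (Fin n) k))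

theorem algebraMap_mem (d : ℕ) (c : C.toSubalgebra) (hc : c ∈ C.grading d) :
    algebraMap C.toSubalgebra (MvPolynomial (Fin n) k) c ∈
      MvPolynomial.homogeneousSubmodule (Fin n) k d := hc

theorem toIdeal_extendedIrrelevant : C.extendedIrrelevant.toIdeal =
    (HomogeneousIdeal.irrelevant C.grading).toIdeal.map
      (algebraMap C.toSubalgebra (MvPolynomial (Fin n) k)) := rfl

theorem one_notMem_extendedIrrelevant : (1 : MvPolynomial (Fin n) k) ∉
    C.extendedIrrelevant.toIdeal := by
  intro h
  rw [toIdeal_extendedIrrelevant] at h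
  have h1 : (1 : MvPolynomial (Fin n) k) ∈ (HomogeneousIdeal.irrelevant
      (MvPolynomial.homogeneousSubmodule (Fin n) k)).toIdeal :=
    (Ideal.map_le_iff_le_comap.mpr fun r hr => Ideal.mem_comap.mpr
      (algebraMap_mem_irrelevant C.algebraMap_mem hr)) h
  rw [mem_irrelevant_iff_coeff, MvPolynomial.coeff_zero_one] at h1
  exact one_ne_zero h1

theorem nontrivial_residueModule : Nontrivial (ResidueModule C.grading) := by
  refine Ideal.Quotient.nontrivial_iff.mpr fun h => C.one_notMem_extendedIrrelevant ?_
  rw [toIdeal_extendedIrrelevant, h, Ideal.map_top]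
  trivial

theorem nontrivial_quotientGrading_zero : Nontrivial (C.extendedIrrelevant.quotientGrading 0) := by
  rw [← not_subsingleton_iff_nontrivial]
  exact fun h => C.one_notMem_extendedIrrelevant
    (HomogeneousIdeal.mem_of_subsingleton_quotientGrading h SetLike.GradedOne.one_mem)

theorem torEnd_residue_zero : torEnd C.grading (residueGrading C.grading) 0 = 0 := by
  have := C.nontrivial_residueModule
  refine le_antisymm ?_ ?_
  · exact_mod_cast gradedEnd_le_natCast (b := 0) fun d hd =>
      GradedFreeResolution.subsingleton_homology_zero _ hd.ne'
  · have := (GradedFreeResolution.nonempty C.grading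
      (residueGrading C.grading)).some.nontrivial_homology_zero
    exact_mod_cast le_gradedEnd (X := fun d => GradedTor C.grading (residueGrading C.grading)
      (residueGrading C.grading) 0 d) 0

end HomogeneousSubalgebra
end

theorem theorem1p3 {k : Type u} [Field k] (n : ℕ)
    (C : HomogeneousSubalgebra (MvPolynomial.homogeneousSubmodule (Fin n) k))
    (hsplit : C.IsSplit)
    (I : HomogeneousIdeal (MvPolynomial.homogeneousSubmodule (Fin n) k))
    (hI : I = C.extendedIrrelevant)
    (e : EReal) (he : e = gradedEnd fun d => I.quotientGrading d) :
    torEnd C.grading (residueGrading C.grading) 0 = 0 ∧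
    torEnd C.grading (residueGrading C.grading) 1 ≤ e + 1 ∧
    (∀ i : ℕ, 2 ≤ i →
      torEnd C.grading (residueGrading C.grading) i ≤ (e + 2) * (i : EReal) - 2) ∧
    (torEnd (MvPolynomial.homogeneousSubmodule (Fin n) k) I.grading 1 ≤ e + 1 →
      ∀ i : ℕ, 2 ≤ i →
        torEnd C.grading (residueGrading C.grading) i ≤ (e + 1) * (i : EReal) - 1) := by
  obtain ⟨π, hπ, hπ'⟩ := hsplit.exists_map_irrelevant
  refine ⟨C.torEnd_residue_zero, ?_⟩
  subst hI
  have hcase := gradedEnd_eq_natCast_or_top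
    (X := fun d => C.extendedIrrelevant.quotientGrading d) C.nontrivial_quotientGrading_zero
  rw [← he] at hcase
  obtain htop | ⟨N, hN⟩ := hcase
  -- For infinite `e` the right-hand sides are infinite, since `i` is positive.
  · have hmul : ∀ i : ℕ, 2 ≤ i → (⊤ : EReal) * i = ⊤ := fun i hi =>
      EReal.top_mul_of_pos (by exact_mod_cast (by omega : 0 < i))
    have h2 : (⊤ : EReal) + 2 = ⊤ := rfl
    have h1 : (⊤ : EReal) + 1 = ⊤ := rfl
    have h2' : (⊤ : EReal) - 2 = ⊤ := rfl
    have h1' : (⊤ : EReal) - 1 = ⊤ := rfl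
    rw [htop, h1, h2]
    refine ⟨le_top, fun i hi => ?_, fun _ i hi => ?_⟩
    · rw [hmul i hi, h2']
      exact le_top
    · rw [hmul i hi, h1']
      exact le_top
  · have hlarge : ∀ m, N < m → ∀ b ∈ MvPolynomial.homogeneousSubmodule (Fin n) k m,
        b ∈ (HomogeneousIdeal.irrelevant C.grading).toIdeal.map
          (algebraMap C.toSubalgebra (MvPolynomial (Fin n) k)) := by
      intro m hm b hb
      rw [← C.toIdeal_extendedIrrelevant]
      refine HomogeneousIdeal.mem_of_subsingleton_quotientGrading
        (subsingleton_of_gradedEnd_lt (X := fun d => C.extendedIrrelevant.quotientGrading d) ?_) hb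
      rw [← he, hN]
      exact_mod_cast hm
    rw [hN]
    refine ⟨?_, fun i hi => ?_, fun h i hi => ?_⟩
    · have := gradedEnd_le_natCast (b := N + 1)
        (X := fun d => GradedTor C.grading (residueGrading C.grading)
          (residueGrading C.grading) 1 d)
        fun d hd => GradedFreeResolution.subsingleton_homology_one _ C.algebraMap_mem π hπ hπ'
          hlarge hd
      exact_mod_cast this
    · obtain ⟨i, rfl⟩ := Nat.exists_eq_add_of_le' hi
      have := gradedEnd_le_natCast (b := (N + 2) * (i + 2) - 2)
        (X := fun d => GradedTor C.grading (residueGrading C.grading) (residueGrading C.grading)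
          (i + 2) d)
        fun d hd => GradedFreeResolution.subsingleton_homology_add_two _ C.algebraMap_mem π hπ hπ'
          hlarge i (by omega)
      rw [EReal.natCast_sub_of_le (by rw [mul_add]; omega)] at this
      exact_mod_cast this
    · obtain ⟨i, rfl⟩ := Nat.exists_eq_add_of_le' hi
      -- The hypothesis on Tor₁(I, k) enters only through its vanishing in the single degree `N +
      -- 2`.
      have hV := exists_koszul_primitive_of_subsingleton C.extendedIrrelevant _
        (subsingleton_of_gradedEnd_lt (d := N + 2) (lt_of_le_of_lt h (by
          exact_mod_cast Nat.lt_succ_self (N + 1))))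
        (hlarge (N + 1) (Nat.lt_succ_self N))
      have := gradedEnd_le_natCast (b := (N + 1) * (i + 2) - 1)
        (X := fun d => GradedTor C.grading (residueGrading C.grading) (residueGrading C.grading)
          (i + 2) d)
        fun d hd => GradedFreeResolution.subsingleton_homology_add_two_of_koszul _
          C.algebraMap_mem π hπ hπ' hlarge hV i (by omega)
      rw [EReal.natCast_sub_of_le (by rw [mul_add]; omega)] at this
      exact_mod_cast this
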